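/- **Conventions.** A $C^*$-seminorm on a unital complex $*$-algebra $\mathcal A$ is a seminorm $p$ with $p(1)=1$, $p(ab)\le p(a)p(b)$, $p(a^*a)=p(a)^2$. A unital Fréchet locally $C^*$-algebra is a complete Hausdorff topological $*$-algebra $\mathcal A$ with unit whose topology is defined by an increasing sequence $\Gamma=\{p_m\}_{m\ge1}$ of $C^*$-seminorms. $p_m^n$ denotes the $C^*$-seminorm on $M_n(\mathcal A)$ given by the norm of the image in $M_n(\mathcal A_m)$, where $\mathcal A_m$ is the $C^*$-algebra obtained as the Hausdorff completion of $\mathcal A$ for $p_m$. For $a\in M_n(\mathcal A)$ write $a=_m0$ if $p_m^n(a)=0$, and $a\ge_m0$ if $a=b^*b+c$ with $b,c\in M_n(\mathcal A)$ and $c=_m0$. A local operator system is a self-adjoint linear subspace $\mathcal S\subseteq\mathcal A$ containing $1$; it generates $\mathcal A$ if the $*$-subalgebra generated by $\mathcal S$ is dense in $\mathcal A$. Let $\mathcal S_1\subseteq\mathcal A_1$, $\mathcal S_2\subseteq\mathcal A_2$ be local operator systems, the topologies being given by $\{p_m\}_{m\ge1}$ and $\{q_m\}_{m\ge1}$. A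 linear map $\varphi:\mathcal S_1\to\mathcal S_2$ is local completely positive if for each $l$ there is $m$ such that for all $n$ and all $[a_{ij}]\in M_n(\mathcal S_1)$: $[a_{ij}]\ge_m0$ implies $[\varphi(a_{ij})]\ge_l0$, and $[a_{ij}]=_m0$ implies $[\varphi(a_{ij})]=_l0$. It is local completely isometric if moreover $q_m^n([\varphi(a_{ij})])=p_m^n([a_{ij}])$ for all $m,n\ge1$ and all $[a_{ij}]\in M_n(\mathcal S_1)$. For a Hilbert space $\mathcal K$, a linear map $\psi:\mathcal A\to B(\mathcal K)$ is $m$-completely positive if for all $n$ and $[a_{ij}]\in M_n(\mathcal A)$: $[a_{ij}]\ge_m0$ implies $[\psi(a_{ij})]\ge0$ in $B(\mathcal K^{\oplus n})$, and $[a_{ij}]=_m0$ implies $[\psi(a_{ij})]=0$. A $p_m$-boundary representation for a local operator system $\mathcal S\subseteq\mathcal A$ is a continuous $*$-homomorphism $\pi:\mathcal A\to B(\mathcal K)$ that is irreducible ($\mathcal K\neq0$ and only $0$ and $\mathcal K$ are closed invariant subspaces) and is the unique unital $m$-completely positive map $\mathcal A\to B(\mathcal K)$ that extends $\pi|_{\mathcal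 S}$. A Fréchet quantized domain $\{\mathcal H;\mathcal E;\mathcal D\}$ is a Hilbert space $\mathcal H$ with an increasing sequence $\mathcal E=\{\mathcal H_m\}_{m\ge1}$ of closed subspaces whose union $\mathcal D$ is dense in $\mathcal H$. $C^*_{\mathcal E}(\mathcal D)$ is the $*$-algebra of linear operators $T$ on $\mathcal D$ with $T(\mathcal H_m)\subseteq\mathcal H_m$, $T(\mathcal H_m^\perp\cap\mathcal D)\subseteq\mathcal H_m^\perp\cap\mathcal D$ and $T|_{\mathcal H_m}$ bounded for all $m$, with involution the adjoint restricted to $\mathcal D$ and $C^*$-seminorms $\|T\|_m=\|T|_{\mathcal H_m}\|$. A local representation is a $*$-homomorphism $\pi:\mathcal A\to C^*_{\mathcal E}(\mathcal D)$ such that for each $m$ there is $l$ with $\|\pi(a)\|_m\le p_l(a)$ for all $a\in\mathcal A$. Put $\mathcal K_1=\mathcal H_1$ and $\mathcal K_m=\mathcal H_{m-1}^\perp\cap\mathcal H_m$ for $m\ge2$, and $\pi_m(a)=\pi(a)|_{\mathcal K_m}\in B(\mathcal K_m)$. A local representation $\pi$ is a $\Gamma$-boundary representation for $\mathcal S$ if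 $\pi_m$ is a $p_m$-boundary representation for $\mathcal S$ for every $m\ge1$. **Proposition.** Let $\mathcal A_1$ and $\mathcal A_2$ be unital Fréchet locally $C^*$-algebras with topologies given by $\Gamma_1=\{p_m\}_{m\ge1}$ and $\Gamma_2=\{q_m\}_{m\ge1}$, and let $\mathcal S_1\subseteq\mathcal A_1$ and $\mathcal S_2\subseteq\mathcal A_2$ be local operator systems that generate $\mathcal A_1$ and $\mathcal A_2$ respectively. Let $\varphi:\mathcal S_1\to\mathcal S_2$ be a unital surjective local completely isometric map. Then for every Fréchet quantized domain $\{\mathcal H;\mathcal E;\mathcal D\}$ and every $\Gamma_1$-boundary representation $\pi_1:\mathcal A_1\to C^*_{\mathcal E}(\mathcal D)$ for $\mathcal S_1$ there exists a $\Gamma_2$-boundary representation $\pi_2:\mathcal A_2\to C^*_{\mathcal E}(\mathcal D)$ for $\mathcal S_2$, on the same quantized domain, such that $\pi_2\circ\varphi=\pi_1|_{\mathcal S_1}$. -/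

import Mathlib

open scoped InnerProductSpace Matrix

noncomputable section

namespace LocalCStar

universe u v w

/-! ### C⋆-seminorms and the associated C⋆-algebras -/

/-- A C⋆-seminorm on a unital complex `⋆`-algebra: a sub-multiplicative seminorm `p` with
`p 1 = 1` and `p (a⋆ a) = p a ^ 2`. -/
structure CStarSeminorm (A : Type u) [Ring A] [StarRing A] [Algebra ℂ A]
    extends Seminorm ℂ A where
  map_one' : toFun 1 = 1
  map_mul_le' : ∀ a b, toFun (a * b) ≤ toFun a * toFun b
  map_star_mul_self' : ∀ a, toFun (star a * a) = toFun a ^ 2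

section Completion

variable {A : Type u} [Ring A] [StarRing A] [Algebra ℂ A]

instance : CoeFun (CStarSeminorm A) (fun _ => A → ℝ) := ⟨fun p => p.toSeminorm⟩

theorem CStarSeminorm.map_star (p : CStarSeminorm A) (a : A) : p (star a) = p a := by
  have key : ∀ b : A, p b ≤ p (star b) := by
    intro b
    have h1 : p (star b * b) = p b ^ 2 := p.map_star_mul_self' b
    have h2 : p (star b * b) ≤ p (star b) * p b := p.map_mul_le' _ _
    have h3 : 0 ≤ p b := apply_nonneg p.toSeminorm b
    have h4 : 0 ≤ p (star b) := apply_nonneg p.toSeminorm (star b)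
    by_contra h
    push Not at h
    nlinarith
  refine le_antisymm ?_ (key a)
  have := key (star a)
  rwa [star_star] at this

/-- The algebra `A` carrying the single seminorm `p` (a copy of `A`, which keeps this seminorm
apart from the topology of `A`). -/
def CStarSeminorm.Space (_p : CStarSeminorm A) : Type u := A

instance (p : CStarSeminorm A) : Ring p.Space := inferInstanceAs (Ring A)
instance (p : CStarSeminorm A) : StarRing p.Space := inferInstanceAs (StarRing A)
instance (p : CStarSeminorm A) : Algebra ℂ p.Space := inferInstanceAs (Algebra ℂ A)
instance [StarModule ℂ A] (p : CStarSeminorm A) : StarModule ℂ p.Space := inferInstanceAs (StarModule ℂ A)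

instance (p : CStarSeminorm A) : SeminormedRing p.Space where
  __ : SeminormedAddCommGroup p.Space :=
    AddGroupSeminorm.toSeminormedAddCommGroup (E := p.Space) p.toSeminorm.toAddGroupSeminorm
  __ : Ring p.Space := inferInstance
  norm_mul_le := p.map_mul_le'

theorem CStarSeminorm.norm_space (p : CStarSeminorm A) (a : p.Space) :
    ‖a‖ = p.toSeminorm (show A from a) := rfl

instance (p : CStarSeminorm A) : NormedAlgebra ℂ p.Space where
  norm_smul_le r a := (map_smul_eq_mul p.toSeminorm r (show A from a)).le

instance (p : CStarSeminorm A) : NormedStarGroup p.Space where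
  norm_star_le a := (p.map_star (show A from a)).le

/-- The C⋆-algebra `A_p` associated with the C⋆-seminorm `p`: the Hausdorff completion of `A` for
`p`, that is, the completion of `A / ker p` for the norm induced by `p`. -/
def CStarSeminorm.Alg (p : CStarSeminorm A) : Type u := UniformSpace.Completion p.Space

instance (p : CStarSeminorm A) : NormedRing p.Alg :=
  inferInstanceAs (NormedRing (UniformSpace.Completion p.Space))
instance (p : CStarSeminorm A) : Algebra ℂ p.Alg :=
  inferInstanceAs (Algebra ℂ (UniformSpace.Completion p.Space))
instance (p : CStarSeminorm A) : NormedAlgebra ℂ p.Alg where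
  norm_smul_le r x := norm_smul_le (α := ℂ) (β := UniformSpace.Completion p.Space) r x
instance (p : CStarSeminorm A) : CompleteSpace p.Alg :=
  inferInstanceAs (CompleteSpace (UniformSpace.Completion p.Space))

/-- The canonical map `A → A_p`. -/
def CStarSeminorm.toAlg (p : CStarSeminorm A) (a : A) : p.Alg :=
  ((show p.Space from a : p.Space) : UniformSpace.Completion p.Space)

theorem CStarSeminorm.norm_toAlg (p : CStarSeminorm A) (a : A) : ‖p.toAlg a‖ = p a :=
  UniformSpace.Completion.norm_coe (E := p.Space) a

theorem CStarSeminorm.denseRange_toAlg (p : CStarSeminorm A) : DenseRange p.toAlg :=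
  UniformSpace.Completion.denseRange_coe (α := p.Space)

theorem CStarSeminorm.toAlg_add (p : CStarSeminorm A) (a b : A) :
    p.toAlg (a + b) = p.toAlg a + p.toAlg b :=
  UniformSpace.Completion.coe_add (α := p.Space) a b

theorem CStarSeminorm.toAlg_mul (p : CStarSeminorm A) (a b : A) :
    p.toAlg (a * b) = p.toAlg a * p.toAlg b :=
  UniformSpace.Completion.coe_mul (α := p.Space) a b

theorem CStarSeminorm.toAlg_smul (p : CStarSeminorm A) (r : ℂ) (a : A) :
    p.toAlg (r • a) = r • p.toAlg a :=
  UniformSpace.Completion.coe_smul (X := p.Space) r a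

instance (p : CStarSeminorm A) : Star p.Alg :=
  ⟨UniformSpace.Completion.map (fun a : p.Space => star a)⟩

theorem CStarSeminorm.continuous_star (p : CStarSeminorm A) :
    Continuous (fun x : p.Alg => star x) :=
  UniformSpace.Completion.continuous_map (α := p.Space) (β := p.Space)

theorem CStarSeminorm.toAlg_star (p : CStarSeminorm A) (a : A) :
    p.toAlg (star a) = star (p.toAlg a) := by
  have h : UniformContinuous (fun a : p.Space => star a) :=
    (starNormedAddGroupHom (E := p.Space)).uniformContinuous
  exact (UniformSpace.Completion.map_coe h (show p.Space from a)).symm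

instance (p : CStarSeminorm A) : StarRing p.Alg where
  star_involutive x := by
    have hc := p.continuous_star
    refine p.denseRange_toAlg.induction_on (p := fun x => star (star x) = x) x
      (isClosed_eq (hc.comp hc) continuous_id) (fun a => ?_)
    rw [← p.toAlg_star, ← p.toAlg_star, star_star]
  star_mul x y := by
    have hc := p.continuous_star
    refine p.denseRange_toAlg.induction_on₂ (p := fun x y => star (x * y) = star y * star x)
      (isClosed_eq (hc.comp continuous_mul)
        ((hc.comp continuous_snd).mul (hc.comp continuous_fst))) (fun a b => ?_) x y
    rw [← p.toAlg_mul, ← p.toAlg_star, ← p.toAlg_star, ← p.toAlg_star, ← p.toAlg_mul, star_mul]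
  star_add x y := by
    have hc := p.continuous_star
    refine p.denseRange_toAlg.induction_on₂ (p := fun x y => star (x + y) = star x + star y)
      (isClosed_eq (hc.comp continuous_add)
        ((hc.comp continuous_fst).add (hc.comp continuous_snd))) (fun a b => ?_) x y
    rw [← p.toAlg_add, ← p.toAlg_star, ← p.toAlg_star, ← p.toAlg_star, ← p.toAlg_add, star_add]

variable [StarModule ℂ A]

instance (p : CStarSeminorm A) : StarModule ℂ p.Alg where
  star_smul r x := by
    have hc := p.continuous_star
    refine p.denseRange_toAlg.induction_on (p := fun x => star (r • x) = star r • star x) x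
      (isClosed_eq (hc.comp (continuous_const_smul r)) (hc.const_smul (star r))) (fun a => ?_)
    rw [← p.toAlg_smul, ← p.toAlg_star, ← p.toAlg_star, ← p.toAlg_smul, star_smul]

instance (p : CStarSeminorm A) : CStarRing p.Alg where
  norm_mul_self_le x := by
    have hc := p.continuous_star
    refine p.denseRange_toAlg.induction_on (p := fun x => ‖x‖ * ‖x‖ ≤ ‖star x * x‖) x
      (isClosed_le (continuous_norm.mul continuous_norm)
        (continuous_norm.comp (hc.mul continuous_id))) (fun a => ?_)
    rw [← p.toAlg_star, ← p.toAlg_mul, p.norm_toAlg, p.norm_toAlg, ← pow_two]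
    exact (p.map_star_mul_self' a).ge

instance (p : CStarSeminorm A) : CStarAlgebra p.Alg where

instance (p : CStarSeminorm A) : PartialOrder p.Alg := CStarAlgebra.spectralOrder p.Alg
instance (p : CStarSeminorm A) : StarOrderedRing p.Alg := CStarAlgebra.spectralOrderedRing p.Alg

/-- The C⋆-seminorm `pⁿ` on `M_n(A)`: the norm of the image of the matrix in the C⋆-algebra
`M_n(A_p)`. -/
def CStarSeminorm.matSeminorm (p : CStarSeminorm A) {n : ℕ} (a : Matrix (Fin n) (Fin n) A) : ℝ :=
  ‖CStarMatrix.ofMatrix (a.map p.toAlg)‖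

/-- `a =_p 0` for a matrix `a` over `A`. -/
def CStarSeminorm.IsNull (p : CStarSeminorm A) {n : ℕ} (a : Matrix (Fin n) (Fin n) A) : Prop :=
  p.matSeminorm a = 0

/-- `a ≥_p 0` for a matrix `a` over `A`: `a = b⋆ b + c` in `M_n(A)` with `c =_p 0`. -/
def CStarSeminorm.IsPos (p : CStarSeminorm A) {n : ℕ} (a : Matrix (Fin n) (Fin n) A) : Prop :=
  ∃ b c : Matrix (Fin n) (Fin n) A, a = bᴴ * b + c ∧ p.IsNull c

end Completion

/-! ### Fréchet locally C⋆-algebras and local operator systems -/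

/-- The unital `⋆`-algebra `A`, with its topology, is a Fréchet locally C⋆-algebra whose
topology is defined by the upward filtered sequence `Γ` of C⋆-seminorms. The sequence is indexed
from `0`. -/
structure IsFrechetLocallyCStarAlgebra {A : Type u} [Ring A] [StarRing A] [Algebra ℂ A]
    [UniformSpace A] (Γ : ℕ → CStarSeminorm A) : Prop where
  isUniformAddGroup : IsUniformAddGroup A
  completeSpace : CompleteSpace A
  t2Space : T2Space A
  mono : Monotone fun m => (Γ m).toSeminorm
  withSeminorms : WithSeminorms (𝕜 := ℂ) fun m => (Γ m).toSeminorm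

section Systems

variable {A : Type u} [Ring A] [StarRing A] [Algebra ℂ A]

/-- A local operator system: a self-adjoint linear subspace containing the unit. -/
structure IsLocalOperatorSystem (S : Submodule ℂ A) : Prop where
  one_mem : (1 : A) ∈ S
  star_mem : ∀ a ∈ S, star a ∈ S

/-- `S` generates `A`: the closure of the `⋆`-subalgebra generated by `S` is `A`. -/
def Generates [StarModule ℂ A] [TopologicalSpace A] (S : Submodule ℂ A) : Prop :=
  closure (StarAlgebra.adjoin ℂ (S : Set A) : Set A) = Set.univ

end Systems

section Maps

variable {A : Type u} [Ring A] [StarRing A] [Algebra ℂ A] [StarModule ℂ A]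
variable {B : Type v} [Ring B] [StarRing B] [Algebra ℂ B] [StarModule ℂ B]

/-- Local completely positive maps between subspaces of `A` and `B`; positivity of a matrix over a
subspace is positivity in the matrices over the ambient algebra. -/
def IsLocalCP (Γ₁ : ℕ → CStarSeminorm A) (Γ₂ : ℕ → CStarSeminorm B)
    {S₁ : Submodule ℂ A} {S₂ : Submodule ℂ B} (φ : S₁ →ₗ[ℂ] S₂) : Prop :=
  ∀ l : ℕ, ∃ m : ℕ, ∀ (n : ℕ) (a : Matrix (Fin n) (Fin n) S₁),
    ((Γ₁ m).IsPos (a.map fun s => (s : A)) → (Γ₂ l).IsPos (a.map fun s => (φ s : B))) ∧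
    ((Γ₁ m).IsNull (a.map fun s => (s : A)) → (Γ₂ l).IsNull (a.map fun s => (φ s : B)))

/-- Local completely isometric maps. -/
structure IsLocalCompletelyIsometric (Γ₁ : ℕ → CStarSeminorm A) (Γ₂ : ℕ → CStarSeminorm B)
    {S₁ : Submodule ℂ A} {S₂ : Submodule ℂ B} (φ : S₁ →ₗ[ℂ] S₂) : Prop where
  localCP : IsLocalCP Γ₁ Γ₂ φ
  isometric : ∀ (m n : ℕ) (a : Matrix (Fin n) (Fin n) S₁),
    (Γ₂ m).matSeminorm (a.map fun s => (φ s : B)) = (Γ₁ m).matSeminorm (a.map fun s => (s : A))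

end Maps

/-! ### Representations on a Hilbert space, boundary representations -/

section Hilbert

variable {H : Type w} [NormedAddCommGroup H] [InnerProductSpace ℂ H]

/-- The operator on the Hilbert space `H ⊕ ⋯ ⊕ H` given by a matrix of operators on `H`. -/
def matOp {n : ℕ} (T : Matrix (Fin n) (Fin n) (H →L[ℂ] H)) :
    PiLp 2 (fun _ : Fin n => H) →L[ℂ] PiLp 2 (fun _ : Fin n => H) :=
  ((PiLp.continuousLinearEquiv 2 ℂ (fun _ : Fin n => H)).symm : (Fin n → H) →L[ℂ] _) ∘L
    (ContinuousLinearMap.pi fun i => ∑ j, T i j ∘L ContinuousLinearMap.proj j) ∘L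
    (PiLp.continuousLinearEquiv 2 ℂ (fun _ : Fin n => H) : _ →L[ℂ] (Fin n → H))

variable {A : Type u} [Ring A] [StarRing A] [Algebra ℂ A] [StarModule ℂ A]

/-- `p`-completely positive maps from `A` to `B(H)`. -/
def IsCPFor (p : CStarSeminorm A) (φ : A →ₗ[ℂ] (H →L[ℂ] H)) : Prop :=
  ∀ (n : ℕ) (a : Matrix (Fin n) (Fin n) A),
    (p.IsPos a → (matOp (a.map φ)).IsPositive) ∧ (p.IsNull a → matOp (a.map φ) = 0)

/-- Irreducible representations of `A` on `H`: continuous `⋆`-homomorphisms to `B(H)`, with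
`H ≠ 0`, which leave no closed subspaces invariant except `0` and `H`. -/
structure IsIrreducibleRep [CompleteSpace H] [TopologicalSpace A]
    (π : A →ₗ[ℂ] (H →L[ℂ] H)) : Prop where
  map_mul : ∀ a b, π (a * b) = π a * π b
  map_star : ∀ a, π (star a) = star (π a)
  continuous : Continuous π
  nontrivial : Nontrivial H
  irreducible : ∀ K : Submodule ℂ H, IsClosed (K : Set H) →
    (∀ a, ∀ x ∈ K, π a x ∈ K) → K = ⊥ ∨ K = ⊤

/-- `p`-boundary representations of `A` for the local operator system `S`: `π` is an irreducible
representation and it is the unique unital `p`-completely positive map on `A` that extends the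
restriction of `π` to `S`. -/
structure IsBoundaryRep [CompleteSpace H] [TopologicalSpace A] (p : CStarSeminorm A)
    (S : Submodule ℂ A) (π : A →ₗ[ℂ] (H →L[ℂ] H)) : Prop where
  irreducibleRep : IsIrreducibleRep π
  map_one : π 1 = 1
  cp : IsCPFor p π
  unique : ∀ ψ : A →ₗ[ℂ] (H →L[ℂ] H), ψ 1 = 1 → IsCPFor p ψ → (∀ s ∈ S, ψ s = π s) → ψ = π

end Hilbert

/-! ### Quantized domains and the algebra `C⋆_E(D)` -/

/-- A Fréchet quantized domain in the Hilbert space `H`: an increasing sequence of closed subspaces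
whose union is dense in `H`. The sequence is indexed from `0`. -/
structure QuantizedDomain (H : Type w) [NormedAddCommGroup H] [InnerProductSpace ℂ H] where
  level : ℕ → Submodule ℂ H
  isClosed_level : ∀ m, IsClosed (level m : Set H)
  mono : Monotone level
  dense : Dense (⋃ m, (level m : Set H))

section Quantized

variable {H : Type w} [NormedAddCommGroup H] [InnerProductSpace ℂ H]

/-- The union space `D` of a quantized domain. -/
def QuantizedDomain.domain (E : QuantizedDomain H) : Submodule ℂ H where
  carrier := ⋃ m, (E.level m : Set H)
  zero_mem' := Set.mem_iUnion.2 ⟨0, (E.level 0).zero_mem⟩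
  add_mem' := by
    intro x y hx hy
    obtain ⟨i, hi⟩ := Set.mem_iUnion.1 hx
    obtain ⟨j, hj⟩ := Set.mem_iUnion.1 hy
    exact Set.mem_iUnion.2 ⟨max i j, (E.level (max i j)).add_mem
      (E.mono (le_max_left i j) hi) (E.mono (le_max_right i j) hj)⟩
  smul_mem' := by
    intro c x hx
    obtain ⟨i, hi⟩ := Set.mem_iUnion.1 hx
    exact Set.mem_iUnion.2 ⟨i, (E.level i).smul_mem c hi⟩

theorem QuantizedDomain.level_le (E : QuantizedDomain H) (m : ℕ) : E.level m ≤ E.domain :=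
  fun _ hx => Set.mem_iUnion.2 ⟨m, hx⟩

theorem QuantizedDomain.exists_level (E : QuantizedDomain H) (x : E.domain) :
    ∃ m, (x : H) ∈ E.level m := Set.mem_iUnion.1 x.2

instance [CompleteSpace H] (E : QuantizedDomain H) (m : ℕ) : CompleteSpace (E.level m) :=
  (E.isClosed_level m).completeSpace_coe

/-- The blocks `K_0 = H_0` and `K_{m+1} = H_m^⊥ ∩ H_{m+1}` of a quantized domain. -/
def QuantizedDomain.block (E : QuantizedDomain H) : ℕ → Submodule ℂ H
  | 0 => E.level 0
  | m + 1 => (E.level m)ᗮ ⊓ E.level (m + 1)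

theorem QuantizedDomain.block_le_level (E : QuantizedDomain H) :
    ∀ m, E.block m ≤ E.level m
  | 0 => le_rfl
  | _ + 1 => inf_le_right

theorem QuantizedDomain.isClosed_block (E : QuantizedDomain H) :
    ∀ m, IsClosed (E.block m : Set H)
  | 0 => E.isClosed_level 0
  | m + 1 => (Submodule.isClosed_orthogonal (E.level m)).inter (E.isClosed_level (m + 1))

instance [CompleteSpace H] (E : QuantizedDomain H) (m : ℕ) : CompleteSpace (E.block m) :=
  (E.isClosed_block m).completeSpace_coe

/-- Membership of a linear operator `T` on `D` in `C⋆_E(D)`: each `H_m` and each `H_m^⊥ ∩ D` is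
invariant under `T`, and the restriction of `T` to `H_m` is bounded. -/
structure IsCStarE (E : QuantizedDomain H) (T : Module.End ℂ E.domain) : Prop where
  mem_level : ∀ m (x : E.domain), (x : H) ∈ E.level m → (T x : H) ∈ E.level m
  mem_orthogonal : ∀ m (x : E.domain), (x : H) ∈ (E.level m)ᗮ → (T x : H) ∈ (E.level m)ᗮ
  bounded : ∀ m, ∃ C : ℝ, ∀ x : E.domain, (x : H) ∈ E.level m → ‖T x‖ ≤ C * ‖x‖

/-- The algebra `C⋆_E(D)`. -/
def CStarE (E : QuantizedDomain H) : Subalgebra ℂ (Module.End ℂ E.domain) where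
  carrier := {T | IsCStarE E T}
  mul_mem' := by
    intro S T hS hT
    refine ⟨fun m x hx => hS.mem_level m _ (hT.mem_level m x hx),
      fun m x hx => hS.mem_orthogonal m _ (hT.mem_orthogonal m x hx), fun m => ?_⟩
    obtain ⟨C, hC⟩ := hS.bounded m
    obtain ⟨C', hC'⟩ := hT.bounded m
    refine ⟨|C| * C', fun x hx => ?_⟩
    calc ‖S (T x)‖ ≤ C * ‖T x‖ := hC _ (hT.mem_level m x hx)
      _ ≤ |C| * ‖T x‖ := by gcongr; exact le_abs_self C
      _ ≤ |C| * (C' * ‖x‖) := by gcongr; exact hC' x hx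
      _ = |C| * C' * ‖x‖ := by ring
  add_mem' := by
    intro S T hS hT
    refine ⟨fun m x hx => (E.level m).add_mem (hS.mem_level m x hx) (hT.mem_level m x hx),
      fun m x hx => (E.level m)ᗮ.add_mem (hS.mem_orthogonal m x hx) (hT.mem_orthogonal m x hx),
      fun m => ?_⟩
    obtain ⟨C, hC⟩ := hS.bounded m
    obtain ⟨C', hC'⟩ := hT.bounded m
    refine ⟨C + C', fun x hx => ?_⟩
    calc ‖S x + T x‖ ≤ ‖S x‖ + ‖T x‖ := norm_add_le _ _
      _ ≤ C * ‖x‖ + C' * ‖x‖ := add_le_add (hC x hx) (hC' x hx)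
      _ = (C + C') * ‖x‖ := by ring
  algebraMap_mem' := by
    intro r
    refine ⟨fun m x hx => (E.level m).smul_mem r hx, fun m x hx => (E.level m)ᗮ.smul_mem r hx,
      fun m => ⟨‖r‖, fun x _ => ?_⟩⟩
    exact (norm_smul r x).le

/-- The bounded operator on a closed subspace `K ⊆ D` obtained by restricting an operator on `D`
that leaves `K` invariant and is bounded there. -/
def restrictTo (E : QuantizedDomain H) (K : Submodule ℂ H) (hK : K ≤ E.domain)
    (T : Module.End ℂ E.domain) (hT : ∀ x : E.domain, (x : H) ∈ K → (T x : H) ∈ K)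
    (hb : ∃ C : ℝ, ∀ x : E.domain, (x : H) ∈ K → ‖T x‖ ≤ C * ‖x‖) : K →L[ℂ] K :=
  LinearMap.mkContinuousOfExistsBound
    { toFun := fun x => ⟨T ⟨x, hK x.2⟩, hT _ x.2⟩
      map_add' := fun x y => Subtype.ext <|
        congrArg (fun z : E.domain => (z : H)) <| T.map_add ⟨x, hK x.2⟩ ⟨y, hK y.2⟩
      map_smul' := fun c x => Subtype.ext <|
        congrArg (fun z : E.domain => (z : H)) <| T.map_smul c ⟨x, hK x.2⟩ }
    (hb.imp fun _ hC x => hC ⟨x, hK x.2⟩ x.2)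

/-- The restriction of `T ∈ C⋆_E(D)` to `H_m`. -/
def onLevel (E : QuantizedDomain H) (m : ℕ) (T : CStarE E) : E.level m →L[ℂ] E.level m :=
  restrictTo E (E.level m) (E.level_le m) T.1 (T.2.mem_level m) (T.2.bounded m)

theorem coe_onLevel_apply (E : QuantizedDomain H) (m : ℕ) (T : CStarE E) (x : E.level m) :
    (onLevel E m T x : H) = T.1 ⟨x, E.level_le m x.2⟩ := rfl

theorem mem_block_of_mem_block (E : QuantizedDomain H) (T : CStarE E) :
    ∀ (m : ℕ) (x : E.domain), (x : H) ∈ E.block m → (T.1 x : H) ∈ E.block m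
  | 0, x, hx => T.2.mem_level 0 x hx
  | m + 1, x, hx => ⟨T.2.mem_orthogonal m x hx.1, T.2.mem_level (m + 1) x hx.2⟩

/-- The restriction of `T ∈ C⋆_E(D)` to the block `K_m`. -/
def onBlock (E : QuantizedDomain H) (m : ℕ) (T : CStarE E) : E.block m →L[ℂ] E.block m :=
  restrictTo E (E.block m) ((E.block_le_level m).trans (E.level_le m)) T.1
    (mem_block_of_mem_block E T m)
    ((T.2.bounded m).imp fun _ hC x hx => hC x (E.block_le_level m hx))

theorem coe_onBlock_apply (E : QuantizedDomain H) (m : ℕ) (T : CStarE E) (x : E.block m) :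
    (onBlock E m T x : H) = T.1 ⟨x, (E.block_le_level m).trans (E.level_le m) x.2⟩ := rfl

/-- The C⋆-seminorm `‖T‖_m` on `C⋆_E(D)`: the operator norm of the restriction to `H_m`. -/
def levelSeminorm (E : QuantizedDomain H) (m : ℕ) (T : CStarE E) : ℝ := ‖onLevel E m T‖

theorem inner_ext_domain (E : QuantizedDomain H) {y z : E.domain}
    (h : ∀ x : E.domain, ⟪(x : H), (y : H)⟫_ℂ = ⟪(x : H), (z : H)⟫_ℂ) : y = z := by
  have := h (y - z)
  rw [← sub_eq_zero, ← inner_sub_right] at this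
  exact sub_eq_zero.1 (Subtype.ext (inner_self_eq_zero.1 this))

theorem ext_inner_cstarE (E : QuantizedDomain H) {S T : CStarE E}
    (h : ∀ x y : E.domain, ⟪(x : H), (S.1 y : H)⟫_ℂ = ⟪(x : H), (T.1 y : H)⟫_ℂ) : S = T :=
  Subtype.ext <| LinearMap.ext fun y => inner_ext_domain E fun x => h x y

variable [CompleteSpace H]

/-- The value at `y ∈ H_m` of the adjoint of `T` is that of the adjoint of `T|H_m`. -/
theorem inner_adjoint_onLevel (E : QuantizedDomain H) (T : CStarE E) (m : ℕ) (x : E.domain)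
    (y : E.level m) :
    ⟪(x : H), ((onLevel E m T).adjoint y : H)⟫_ℂ = ⟪(T.1 x : H), (y : H)⟫_ℂ := by
  set P := (E.level m).starProjection (x : H) with hP
  have hPm : P ∈ E.level m := Submodule.starProjection_apply_mem _ _
  set u : E.domain := ⟨P, E.level_le m hPm⟩ with hu
  have hperp : ((x - u : E.domain) : H) ∈ (E.level m)ᗮ := Submodule.sub_starProjection_mem_orthogonal _
  have h1 : ⟪((x - u : E.domain) : H), ((onLevel E m T).adjoint y : H)⟫_ℂ = 0 :=
    Submodule.inner_left_of_mem_orthogonal (Subtype.coe_prop _) hperp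
  have h2 : ⟪(T.1 (x - u) : H), (y : H)⟫_ℂ = 0 :=
    Submodule.inner_left_of_mem_orthogonal y.2 (T.2.mem_orthogonal m _ hperp)
  have h3 : ⟪(u : H), ((onLevel E m T).adjoint y : H)⟫_ℂ = ⟪(T.1 u : H), (y : H)⟫_ℂ :=
    (onLevel E m T).adjoint_inner_right ⟨P, hPm⟩ y
  have hx : x = (x - u) + u := (sub_add_cancel x u).symm
  rw [hx, map_add, Submodule.coe_add, Submodule.coe_add, inner_add_left, inner_add_left, h1, h2, h3]

theorem exists_adjoint (E : QuantizedDomain H) (T : CStarE E) :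
    ∃ R : CStarE E, ∀ x y : E.domain,
      ⟪(x : H), (R.1 y : H)⟫_ℂ = ⟪(T.1 x : H), (y : H)⟫_ℂ := by
  have key : ∀ y : E.domain, ∃ z : E.domain,
      ∀ x : E.domain, ⟪(x : H), (z : H)⟫_ℂ = ⟪(T.1 x : H), (y : H)⟫_ℂ := fun y => by
    obtain ⟨m, hm⟩ := E.exists_level y
    exact ⟨⟨(onLevel E m T).adjoint ⟨y, hm⟩, E.level_le m (Subtype.coe_prop _)⟩,
      fun x => inner_adjoint_onLevel E T m x ⟨y, hm⟩⟩
  choose f hf using key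
  have hlev : ∀ m (y : E.domain) (hy : (y : H) ∈ E.level m),
      (f y : H) = (onLevel E m T).adjoint ⟨y, hy⟩ := fun m y hy => by
    have : f y = ⟨(onLevel E m T).adjoint ⟨y, hy⟩, E.level_le m (Subtype.coe_prop _)⟩ :=
      inner_ext_domain E fun x => by
        rw [hf y x]; exact (inner_adjoint_onLevel E T m x ⟨y, hy⟩).symm
    rw [this]
  let R : Module.End ℂ E.domain :=
    { toFun := f
      map_add' := fun y z => inner_ext_domain E fun x => by
        rw [hf, Submodule.coe_add, Submodule.coe_add, inner_add_right, inner_add_right, hf, hf]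
      map_smul' := fun c y => inner_ext_domain E fun x => by
        rw [hf, RingHom.id_apply, Submodule.coe_smul, Submodule.coe_smul, inner_smul_right,
          inner_smul_right, hf] }
  refine ⟨⟨R, ⟨fun m y hy => ?_, fun m y hy => ?_, fun m => ⟨‖(onLevel E m T).adjoint‖,
    fun y hy => ?_⟩⟩⟩, fun x y => hf y x⟩
  · change (f y : H) ∈ E.level m
    rw [hlev m y hy]
    exact Subtype.coe_prop _
  · change (f y : H) ∈ (E.level m)ᗮ
    rw [Submodule.mem_orthogonal]
    intro u hu
    have := hf y ⟨u, E.level_le m hu⟩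
    rw [this]
    exact Submodule.inner_right_of_mem_orthogonal (T.2.mem_level m ⟨u, E.level_le m hu⟩ hu) hy
  · change ‖(f y : H)‖ ≤ _ * ‖(y : H)‖
    rw [hlev m y hy]
    exact (onLevel E m T).adjoint.le_opNorm ⟨y, hy⟩

/-- The involution of `C⋆_E(D)`: `T⋆` is the restriction to `D` of the Hilbert space adjoint of the
densely defined operator `T`; it is determined by `⟪x, T⋆ y⟫ = ⟪T x, y⟫` for `x, y ∈ D`. -/
instance (E : QuantizedDomain H) : Star (CStarE E) :=
  ⟨fun T => (exists_adjoint E T).choose⟩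

theorem inner_star (E : QuantizedDomain H) (T : CStarE E) (x y : E.domain) :
    ⟪(x : H), ((star T).1 y : H)⟫_ℂ = ⟪(T.1 x : H), (y : H)⟫_ℂ :=
  (exists_adjoint E T).choose_spec x y

theorem inner_star_left (E : QuantizedDomain H) (T : CStarE E) (x y : E.domain) :
    ⟪((star T).1 x : H), (y : H)⟫_ℂ = ⟪(x : H), (T.1 y : H)⟫_ℂ := by
  rw [← inner_conj_symm, inner_star, inner_conj_symm]

instance (E : QuantizedDomain H) : StarRing (CStarE E) where
  star_involutive T := ext_inner_cstarE E fun x y => by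
    rw [inner_star, inner_star_left]
  star_mul S T := ext_inner_cstarE E fun x y => by
    rw [inner_star]
    exact (inner_star E S (T.1 x) y).symm.trans (inner_star E T x ((star S).1 y)).symm
  star_add S T := ext_inner_cstarE E fun x y => by
    have h : ((star S + star T : CStarE E).1 y : H) = (star S).1 y + (star T).1 y := rfl
    have h' : ((S + T : CStarE E).1 x : H) = S.1 x + T.1 x := rfl
    rw [inner_star, h, h', inner_add_left, inner_add_right, inner_star, inner_star]

instance (E : QuantizedDomain H) : StarModule ℂ (CStarE E) where
  star_smul r T := ext_inner_cstarE E fun x y => by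
    have h : ((star r • star T : CStarE E).1 y : H) = star r • ((star T).1 y : H) := rfl
    have h' : ((r • T : CStarE E).1 x : H) = r • (T.1 x : H) := rfl
    rw [inner_star, h, h', inner_smul_left, inner_smul_right, inner_star]
    rfl

end Quantized

/-! ### Local representations and `Γ`-boundary representations -/

section Boundary

variable {A : Type u} [Ring A] [StarRing A] [Algebra ℂ A]
variable {H : Type w} [NormedAddCommGroup H] [InnerProductSpace ℂ H] [CompleteSpace H]
variable {E : QuantizedDomain H}

/-- A `⋆`-homomorphism `A → C⋆_E(D)` is a local representation if each `‖π(·)‖_m` is dominated by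
one of the seminorms of `Γ`. -/
def IsLocalRep (Γ : ℕ → CStarSeminorm A) (π : A →⋆ₙₐ[ℂ] CStarE E) : Prop :=
  ∀ m : ℕ, ∃ l : ℕ, ∀ a : A, levelSeminorm E m (π a) ≤ Γ l a

/-- The map `π_m : A → B(K_m)`, `π_m(a) = π(a)|K_m`. -/
def blockMap (π : A →⋆ₙₐ[ℂ] CStarE E) (m : ℕ) : A →ₗ[ℂ] (E.block m →L[ℂ] E.block m) where
  toFun a := onBlock E m (π a)
  map_add' a b := by
    ext x
    rw [map_add]
    rfl
  map_smul' r a := by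
    ext x
    rw [map_smul]
    rfl

/-- `Γ`-boundary representations for `S`: local representations `π` such that every `π_m` is a
`p_m`-boundary representation for `S`. -/
structure IsGammaBoundaryRep [StarModule ℂ A] [TopologicalSpace A] (Γ : ℕ → CStarSeminorm A)
    (S : Submodule ℂ A) (π : A →⋆ₙₐ[ℂ] CStarE E) : Prop where
  localRep : IsLocalRep Γ π
  boundary : ∀ m : ℕ, IsBoundaryRep (Γ m) S (blockMap π m)

end Boundary

end LocalCStar

end

open LocalCStar

noncomputable section

namespace LocalCStar

/-! The blocks of a quantized domain are independent of each other: `D` is their algebraic direct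
sum, and an element of `C⋆_E(D)` is an arbitrary family of bounded operators on the blocks. It
therefore suffices to transfer each boundary representation `ρ = π_m` on `K = K_m` from `A₁` to `A₂`
with a bound by `q_m`; monotonicity of the seminorms makes the assembled map local.

For one block the tool is dilation along a unital complete isometry
(`IsUnitalIsometricPair.exists_dilation`). A contractive representation on one side becomes, on the
distinguished subspace, a compression of a contractive representation of the other side. It merges
the Arveson extension theorem and the Stinespring construction: a functional on finitely supported
`A`-valued kernels on `K × K` is extended by the M. Riesz theorem, and a GNS construction is applied
to it. The positivity needed comes from norms alone, by testing a matrix shifted by scalars.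

Dilate `ρ` to a representation `σ` of `A₂` on `L ⊇ K`, and then `σ` to a representation `θ` of `A₁`
on `L' ⊇ L`. The compression of `θ` to `K` is a unital completely positive extension of `ρ|S₁`, so
it equals `ρ` by the unique extension property. A multiplicative compression is a restriction to a
reducing subspace; hence `θ`, and with it `σ` on `φ(S₁) = S₂`, leaves `K` invariant
(`IsBoundaryRep.apply_eq_of_compression`). Since `S₂` generates, `K` is invariant under `σ(A₂)` and
the compression `ψ` of `σ` is a representation. The same argument, applied to the Stinespring
dilation of any competing extension of `ψ|S₂`, shows that the competitor is multiplicative too, so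
it agrees with `ψ` (`IsBoundaryRep.exists_transfer`). -/

/-- The M. Riesz extension theorem for a functional given along a linear map `J`. -/
theorem exists_positive_extension {E W : Type*} [AddCommGroup E] [Module ℝ E] [AddCommGroup W]
    [Module ℝ W] (s : PointedCone ℝ E) (J : W →ₗ[ℝ] E) (g : W →ₗ[ℝ] ℝ)
    (nonneg : ∀ w, J w ∈ s → 0 ≤ g w) (dense : ∀ y, ∃ w, J w + y ∈ s) :
    ∃ G : E →ₗ[ℝ] ℝ, (∀ w, G (J w) = g w) ∧ ∀ x ∈ s, 0 ≤ G x := by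
  -- Both `w` and `-w` are sent to `0 ∈ s`, so `g` descends to the range of `J`.
  have hker : LinearMap.ker J ≤ LinearMap.ker g := fun w hw => by
    rw [LinearMap.mem_ker] at hw ⊢
    have h1 := nonneg w (hw ▸ s.zero_mem)
    have h2 := nonneg (-w) (by rw [map_neg, hw, neg_zero]; exact s.zero_mem)
    rw [map_neg] at h2
    linarith
  let f : E →ₗ.[ℝ] ℝ :=
    ⟨LinearMap.range J, (LinearMap.ker J).liftQ g hker ∘ₗ J.quotKerEquivRange.symm.toLinearMap⟩
  have hf : ∀ w, f ⟨J w, w, rfl⟩ = g w := fun w => by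
    have : J.quotKerEquivRange.symm ⟨J w, w, rfl⟩ = (LinearMap.ker J).mkQ w :=
      J.quotKerEquivRange_symm_apply_image w _
    change (LinearMap.ker J).liftQ g hker (J.quotKerEquivRange.symm ⟨J w, w, rfl⟩) = _
    rw [this]
    rfl
  obtain ⟨G, hG, hpos⟩ := riesz_extension s f
    (by rintro ⟨_, w, rfl⟩ hw; rw [hf]; exact nonneg w hw)
    (fun y => (dense y).elim fun w hw => ⟨⟨J w, w, rfl⟩, hw⟩)
  exact ⟨G, fun w => (hG ⟨J w, w, rfl⟩).trans (hf w), hpos⟩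

/-! ### The C⋆-algebra `A_p` and extension of representations to it. -/

section Alg

variable {A : Type*} [Ring A] [StarRing A] [Algebra ℂ A]

theorem CStarSeminorm.toAlg_one (p : CStarSeminorm A) : p.toAlg 1 = 1 :=
  UniformSpace.Completion.coe_one p.Space

/-- The canonical map `A → A_p` as a homomorphism of unital `⋆`-algebras. -/
def CStarSeminorm.toAlgHom (p : CStarSeminorm A) : A →⋆ₐ[ℂ] p.Alg where
  toFun := p.toAlg
  map_one' := p.toAlg_one
  map_mul' := p.toAlg_mul
  map_zero' := UniformSpace.Completion.coe_zero (α := p.Space)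
  map_add' := p.toAlg_add
  commutes' r := by
    rw [Algebra.algebraMap_eq_smul_one, p.toAlg_smul, p.toAlg_one, Algebra.algebraMap_eq_smul_one]
  map_star' := p.toAlg_star

theorem CStarSeminorm.coe_toAlgHom (p : CStarSeminorm A) (a : A) : p.toAlgHom a = p.toAlg a := rfl

theorem CStarSeminorm.toAlg_eq_zero {p : CStarSeminorm A} {a : A} : p.toAlg a = 0 ↔ p a = 0 := by
  rw [← norm_eq_zero, p.norm_toAlg]

variable {K : Type*} [NormedAddCommGroup K] [InnerProductSpace ℂ K] [CompleteSpace K]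

/-- A contractive representation of `A` extends to `A_p`. -/
theorem CStarSeminorm.exists_extension (p : CStarSeminorm A) (τ : A →⋆ₐ[ℂ] (K →L[ℂ] K))
    (hτ : ∀ a, ‖τ a‖ ≤ p a) :
    ∃ T : p.Alg →+* (K →L[ℂ] K), (∀ a, T (p.toAlg a) = τ a) ∧ ∀ x, T (star x) = star (T x) := by
  let f : p.Space →+* (K →L[ℂ] K) := (τ : A →+* (K →L[ℂ] K))
  have hf : Continuous f := by
    refine AddMonoidHomClass.continuous_of_bound f 1 fun a => ?_
    rw [one_mul]
    exact hτ a
  let T : p.Alg →+* (K →L[ℂ] K) := UniformSpace.Completion.extensionHom f hf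
  have hT : ∀ a, T (p.toAlg a) = τ a := fun a => UniformSpace.Completion.extensionHom_coe f hf a
  have hTc : Continuous T := UniformSpace.Completion.continuous_extension (f := f)
  refine ⟨T, hT, fun x => ?_⟩
  refine p.denseRange_toAlg.induction_on (p := fun x => T (star x) = star (T x)) x
    (isClosed_eq (hTc.comp p.continuous_star) (hTc.star)) fun a => ?_
  rw [← p.toAlg_star, hT, hT, StarHomClass.map_star]

end Alg

/-! ### Norm and order estimates in a C⋆-algebra. -/

section CStarAlgebra

variable {M : Type*} [CStarAlgebra M]

theorem exists_star_mul_self_eq_norm_sq_sub (c : M) :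
    ∃ d : M, ((‖c‖ ^ 2 : ℝ) : ℂ) • 1 - star c * c = star d * d := by
  let := CStarAlgebra.spectralOrder M
  have := CStarAlgebra.spectralOrderedRing M
  obtain ⟨d, hd⟩ := CStarAlgebra.nonneg_iff_eq_star_mul_self.1
    (sub_nonneg.2 (CStarAlgebra.star_mul_le_algebraMap_norm_sq (a := c)))
  exact ⟨d, by rw [← hd, Algebra.algebraMap_eq_smul_one, Complex.coe_smul]⟩

/-- From `0 ≤ d⋆d ≤ r` follows `0 ≤ r - d⋆d ≤ r`. Positivity is thus visible in the norm of a shift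
by a real scalar. -/
theorem norm_star_mul_self_sub_le (d : M) {r : ℝ} (hr : ‖star d * d‖ ≤ r) :
    ‖star d * d + ((-r : ℝ) : ℂ) • 1‖ ≤ r := by
  let := CStarAlgebra.spectralOrder M
  have := CStarAlgebra.spectralOrderedRing M
  have h0 : 0 ≤ star d * d := star_mul_self_nonneg d
  have h1 : star d * d ≤ algebraMap ℝ M r :=
    (IsSelfAdjoint.star_mul_self d).le_algebraMap_norm_self.trans
      (algebraMap_mono M hr)
  have h2 : 0 ≤ algebraMap ℝ M r - star d * d := sub_nonneg.2 h1
  have h3 : algebraMap ℝ M r - star d * d ≤ algebraMap ℝ M r := sub_le_self _ h0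
  have h4 := (CStarAlgebra.norm_le_iff_le_algebraMap _ ((norm_nonneg _).trans hr) h2).2 h3
  rwa [← norm_neg, neg_sub, sub_eq_add_neg, Algebra.algebraMap_eq_smul_one, ← neg_smul,
    ← Complex.coe_smul] at h4

/-- The cross terms cancel in `(h + it)⋆(h + it) = h² + t²`. Self-adjointness is thus visible in the
norms of the shifts by imaginary scalars. -/
theorem norm_add_I_smul_one_sq_le {h : M} (hh : IsSelfAdjoint h) (t : ℝ) :
    ‖h + ((t : ℂ) * Complex.I) • (1 : M)‖ ^ 2 ≤ ‖h‖ ^ 2 + t ^ 2 := by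
  rw [sq, ← CStarRing.norm_star_mul_self]
  have : star (h + ((t : ℂ) * Complex.I) • (1 : M)) * (h + ((t : ℂ) * Complex.I) • (1 : M)) =
      h * h + ((t ^ 2 : ℝ) : ℂ) • (1 : M) := by
    rw [star_add, star_smul, star_one, hh.star_eq, add_mul, mul_add, mul_add]
    simp only [smul_mul_assoc, mul_smul_comm, one_mul, mul_one, smul_smul]
    have h2 : star ((t : ℂ) * Complex.I) = -((t : ℂ) * Complex.I) := by simp
    have h3 : ((t : ℂ) * Complex.I) * -((t : ℂ) * Complex.I) = ((t ^ 2 : ℝ) : ℂ) := by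
      push_cast; linear_combination (-(t : ℂ) ^ 2) * Complex.I_mul_I
    rw [h2, h3, neg_smul]
    abel
  rw [this]
  refine (norm_add_le _ _).trans (add_le_add ((norm_mul_le _ _).trans (sq _).ge) ?_)
  refine (norm_smul_le _ _).trans ?_
  rcases subsingleton_or_nontrivial M with hM | hM
  · rw [Subsingleton.elim (1 : M) 0, norm_zero, mul_zero]; positivity
  · rw [CStarRing.norm_one, mul_one, Complex.norm_real, Real.norm_of_nonneg (by positivity)]

end CStarAlgebra

/-! ### Complete contractivity of representations. -/

section Matrices

variable {K : Type*} [NormedAddCommGroup K] [InnerProductSpace ℂ K] [CompleteSpace K]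

theorem sum_inner_star_mul {ι κ : Type*} [Fintype ι] [Fintype κ] (M : κ → ι → (K →L[ℂ] K))
    (x : ι → K) :
    ∑ i, ∑ j, ⟪x i, (∑ k, star (M k i) * M k j) (x j)⟫_ℂ =
      ((∑ k, ‖∑ j, M k j (x j)‖ ^ 2 : ℝ) : ℂ) := by
  have h : ∀ k, (((‖∑ j, M k j (x j)‖ ^ 2 : ℝ)) : ℂ) =
      ∑ i, ∑ j, ⟪x i, (star (M k i) * M k j) (x j)⟫_ℂ := fun k => by
    rw [Complex.ofReal_pow]
    refine (inner_self_eq_norm_sq_to_K (𝕜 := ℂ) (∑ j, M k j (x j))).symm.trans ?_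
    rw [sum_inner]
    refine Finset.sum_congr rfl fun i _ => ?_
    rw [inner_sum]
    refine Finset.sum_congr rfl fun j _ => ?_
    rw [ContinuousLinearMap.star_eq_adjoint, _root_.mul_apply_eq_comp,
      ContinuousLinearMap.adjoint_inner_right]
  rw [Complex.ofReal_sum]
  simp_rw [h, _root_.sum_apply, inner_sum]
  rw [Finset.sum_comm' (t' := Finset.univ) (s' := fun _ => Finset.univ) (by simp)]
  conv_rhs => rw [Finset.sum_comm]
  rw [Finset.sum_comm]
  refine Finset.sum_congr rfl fun i _ => ?_
  rw [Finset.sum_comm]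

variable {B : Type*} [Ring B] [StarRing B] [Algebra ℂ B] [StarModule ℂ B]

/-- Contractive representations are completely contractive. -/
theorem sum_norm_sq_le (q : CStarSeminorm B) (τ : B →⋆ₐ[ℂ] (K →L[ℂ] K)) (hτ : ∀ b, ‖τ b‖ ≤ q b)
    {n : ℕ} (c : Matrix (Fin n) (Fin n) B) (x : Fin n → K) :
    ∑ i, ‖∑ j, τ (c i j) (x j)‖ ^ 2 ≤ q.matSeminorm c ^ 2 * ∑ i, ‖x i‖ ^ 2 := by
  obtain ⟨T, hT, hTs⟩ := q.exists_extension τ hτ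
  set C : CStarMatrix (Fin n) (Fin n) q.Alg := CStarMatrix.ofMatrix (c.map q.toAlg) with hC
  obtain ⟨d, hd⟩ := exists_star_mul_self_eq_norm_sq_sub C
  -- The extension of `τ` to `A_p`, applied entrywise, carries `‖C‖² - C⋆C = d⋆d` to operators on
  -- `K`.
  have hentry : ∀ i j, (if i = j then (((‖C‖ ^ 2 : ℝ) : ℂ)) • (1 : K →L[ℂ] K) else 0) -
      ∑ k, star (τ (c k i)) * τ (c k j) = ∑ k, star (T (d k i)) * T (d k j) := fun i j => by
    have := congrArg (fun m : CStarMatrix (Fin n) (Fin n) q.Alg => T (m i j)) hd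
    simp only [CStarMatrix.sub_apply, CStarMatrix.smul_apply, CStarMatrix.mul_apply,
      CStarMatrix.star_apply, map_sub, map_sum, map_mul, hTs] at this
    rw [← this]
    simp only [hC, CStarMatrix.ofMatrix_apply, Matrix.map_apply, hT, CStarMatrix.one_apply]
    congr 1
    split_ifs
    · rw [← q.toAlg_one, ← q.toAlg_smul, hT, map_smul, map_one]
    · rw [smul_zero, map_zero]
  have key := sum_inner_star_mul (fun k i => T (d k i)) x
  simp_rw [← hentry, _root_.sub_apply, inner_sub_right, Finset.sum_sub_distrib] at key
  rw [sum_inner_star_mul (fun k i => τ (c k i)) x] at key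
  have h1 : ∑ i, ∑ j, ⟪x i, (if i = j then (((‖C‖ ^ 2 : ℝ) : ℂ)) • (1 : K →L[ℂ] K) else 0) (x j)⟫_ℂ
      = ((‖C‖ ^ 2 * ∑ i, ‖x i‖ ^ 2 : ℝ) : ℂ) := by
    rw [Complex.ofReal_mul, Complex.ofReal_sum, Finset.mul_sum]
    refine Finset.sum_congr rfl fun i _ => ?_
    rw [Finset.sum_eq_single i (fun j _ hj => by rw [if_neg (Ne.symm hj)]; simp) (by simp)]
    simp [inner_self_eq_norm_sq_to_K]
  rw [h1, ← Complex.ofReal_sub] at key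
  have h2 := Complex.ofReal_injective key
  have h3 : 0 ≤ ∑ k, ‖∑ j, T (d k j) (x j)‖ ^ 2 := by positivity
  have h4 : q.matSeminorm c = ‖C‖ := rfl
  rw [h4]
  linarith

end Matrices

theorem exists_eq_star_mul_self {M : Type*} [CStarAlgebra M] [PartialOrder M] [StarOrderedRing M]
    {a : M} (ha : 0 ≤ a) : ∃ d, a = star d * d :=
  CStarAlgebra.nonneg_iff_eq_star_mul_self.1 ha

/-! ### Unital complete isometries preserve positivity and self-adjointness. -/

section Isometric

variable {A : Type*} [Ring A] [StarRing A] [Algebra ℂ A] [StarModule ℂ A]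
variable {B : Type*} [Ring B] [StarRing B] [Algebra ℂ B] [StarModule ℂ B]
variable {W : Type*} [AddCommGroup W] [Module ℂ W]
variable {K : Type*} [NormedAddCommGroup K] [InnerProductSpace ℂ K] [CompleteSpace K]

/-- Two linear maps from the same space, with values in `A` and `B`, that are unital and induce
the same matrix seminorms. -/
structure IsUnitalIsometricPair (p : CStarSeminorm A) (q : CStarSeminorm B) (j₁ : W →ₗ[ℂ] A)
    (j₂ : W →ₗ[ℂ] B) : Prop where
  exists_one : ∃ e, j₁ e = 1 ∧ j₂ e = 1
  isometric : ∀ (n : ℕ) (a : Matrix (Fin n) (Fin n) W),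
    q.matSeminorm (a.map j₂) = p.matSeminorm (a.map j₁)

variable {p : CStarSeminorm A} {q : CStarSeminorm B} {j₁ : W →ₗ[ℂ] A} {j₂ : W →ₗ[ℂ] B}
variable {τ : B →⋆ₐ[ℂ] (K →L[ℂ] K)}

/-- Expand `‖(τ(M) + c)x‖² ≤ ‖M + c‖²‖x‖²` and drop the term `‖τ(M)x‖²`. The unit common to both
sides is what lets the isometry see the shift by `c`. -/
theorem IsUnitalIsometricPair.two_re_le (hj : IsUnitalIsometricPair p q j₁ j₂)
    (hτ : ∀ b, ‖τ b‖ ≤ q b) {n : ℕ} (M : Matrix (Fin n) (Fin n) W) (x : Fin n → K) (c : ℂ) :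
    2 * (star c * ∑ i, ∑ j, ⟪x i, τ (j₂ (M i j)) (x j)⟫_ℂ).re ≤
      (‖(CStarMatrix.ofMatrix ((M.map j₁).map p.toAlg) + c • 1 :
        CStarMatrix (Fin n) (Fin n) p.Alg)‖ ^ 2 - ‖c‖ ^ 2) * ∑ i, ‖x i‖ ^ 2 := by
  obtain ⟨e, he₁, he₂⟩ := hj.exists_one
  set M' : Matrix (Fin n) (Fin n) W := M + Matrix.diagonal fun _ => c • e with hM'
  have hnorm : CStarMatrix.ofMatrix ((M'.map j₁).map p.toAlg) =
      (CStarMatrix.ofMatrix ((M.map j₁).map p.toAlg) + c • 1 :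
        CStarMatrix (Fin n) (Fin n) p.Alg) := by
    ext i j
    simp only [CStarMatrix.ofMatrix_apply, Matrix.map_apply, hM', Matrix.add_apply,
      CStarMatrix.add_apply, CStarMatrix.smul_apply, CStarMatrix.one_apply, map_add, p.toAlg_add,
      Matrix.diagonal_apply]
    congr 1
    split_ifs
    · rw [map_smul, he₁, p.toAlg_smul, p.toAlg_one]
    · rw [map_zero, smul_zero]; exact map_zero p.toAlgHom
  have h1 := sum_norm_sq_le q τ hτ (M'.map j₂) x
  have h2 : q.matSeminorm (M'.map j₂) = ‖(CStarMatrix.ofMatrix ((M.map j₁).map p.toAlg) + c • 1 :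
        CStarMatrix (Fin n) (Fin n) p.Alg)‖ := by
    rw [hj.isometric, ← hnorm]; rfl
  rw [h2] at h1
  have h3 : ∀ i, ∑ j, τ (M'.map j₂ i j) (x j) = c • x i + ∑ j, τ (j₂ (M i j)) (x j) := fun i => by
    simp only [Matrix.map_apply, hM', Matrix.add_apply, map_add, _root_.add_apply,
      Finset.sum_add_distrib]
    rw [add_comm]
    congr 1
    rw [Finset.sum_eq_single i (fun j _ hj => by rw [Matrix.diagonal_apply_ne' _ hj]; simp)
      (by simp), Matrix.diagonal_apply_eq, map_smul, he₂, map_smul, map_one]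
    rfl
  have h4 : ∀ i, ‖∑ j, τ (M'.map j₂ i j) (x j)‖ ^ 2 ≥ ‖c‖ ^ 2 * ‖x i‖ ^ 2 +
      2 * (star c * ∑ j, ⟪x i, τ (j₂ (M i j)) (x j)⟫_ℂ).re := fun i => by
    rw [h3, norm_add_sq (𝕜 := ℂ), inner_smul_left, norm_smul, mul_pow, ← inner_sum]
    have := sq_nonneg ‖∑ j, τ (j₂ (M i j)) (x j)‖
    simp only [RCLike.re_eq_complex_re, starRingEnd_apply]
    linarith
  have h5 := (Finset.sum_le_sum fun i (_ : i ∈ Finset.univ) => h4 i).trans h1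
  rw [Finset.sum_add_distrib, ← Finset.mul_sum, ← Finset.mul_sum, ← Complex.re_sum,
    ← Finset.mul_sum] at h5
  linarith

/-- With `c = it` the right side of `two_re_le` stays bounded in `t` while the left side is linear
in `t`. No compatibility of `j₂` with the involution is assumed. -/
theorem IsUnitalIsometricPair.im_eq_zero (hj : IsUnitalIsometricPair p q j₁ j₂)
    (hτ : ∀ b, ‖τ b‖ ≤ q b) {n : ℕ} (M : Matrix (Fin n) (Fin n) W) (x : Fin n → K)
    (hM : ∀ i j, j₁ (M j i) = star (j₁ (M i j))) :
    (∑ i, ∑ j, ⟪x i, τ (j₂ (M i j)) (x j)⟫_ℂ).im = 0 := by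
  set z := ∑ i, ∑ j, ⟪x i, τ (j₂ (M i j)) (x j)⟫_ℂ with hz
  set h : CStarMatrix (Fin n) (Fin n) p.Alg :=
    CStarMatrix.ofMatrix ((M.map j₁).map p.toAlg) with hh
  have hsa : IsSelfAdjoint h := by
    ext i j
    rw [CStarMatrix.star_apply]
    simp only [hh, CStarMatrix.ofMatrix_apply, Matrix.map_apply]
    rw [← p.toAlg_star, ← hM]
  have key : ∀ t : ℝ, 2 * t * z.im ≤ ‖h‖ ^ 2 * ∑ i, ‖x i‖ ^ 2 := fun t => by
    have h1 := hj.two_re_le hτ M x ((t : ℂ) * Complex.I)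
    rw [← hz, ← hh] at h1
    have h2 : (star ((t : ℂ) * Complex.I) * z).re = t * z.im := by simp
    have h3 : ‖(t : ℂ) * Complex.I‖ ^ 2 = t ^ 2 := by simp
    rw [h2, h3] at h1
    have h4 := norm_add_I_smul_one_sq_le hsa t
    have h5 : 0 ≤ ∑ i, ‖x i‖ ^ 2 := by positivity
    nlinarith
  by_contra hne
  -- This `t` makes the left side exceed the bound by exactly `1`.
  have h1 := key ((‖h‖ ^ 2 * ∑ i, ‖x i‖ ^ 2 + 1) / (2 * z.im))
  have h2 : 2 * ((‖h‖ ^ 2 * ∑ i, ‖x i‖ ^ 2 + 1) / (2 * z.im)) * z.im =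
    ‖h‖ ^ 2 * ∑ i, ‖x i‖ ^ 2 + 1 := by field_simp
  linarith

/-- With `c = -r` and `r ≥ ‖M‖`, positivity gives `‖M - r‖ ≤ r`, so the right side of `two_re_le` is
at most `0`. -/
theorem IsUnitalIsometricPair.re_nonneg (hj : IsUnitalIsometricPair p q j₁ j₂)
    (hτ : ∀ b, ‖τ b‖ ≤ q b) {n : ℕ} (M : Matrix (Fin n) (Fin n) W) (x : Fin n → K)
    (hM : 0 ≤ (CStarMatrix.ofMatrix ((M.map j₁).map p.toAlg) :
      CStarMatrix (Fin n) (Fin n) p.Alg)) :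
    0 ≤ (∑ i, ∑ j, ⟪x i, τ (j₂ (M i j)) (x j)⟫_ℂ).re := by
  set z := ∑ i, ∑ j, ⟪x i, τ (j₂ (M i j)) (x j)⟫_ℂ with hz
  obtain ⟨d, hd⟩ := exists_eq_star_mul_self hM
  -- The summand `1` keeps `r` strictly positive, so that it can be divided out.
  set r : ℝ := ‖star d * d‖ + 1
  have h1 := hj.two_re_le hτ M x (((-r : ℝ) : ℂ))
  rw [← hz, hd] at h1
  have h2 := norm_star_mul_self_sub_le d (r := r) (by linarith)
  have h3 : (star (((-r : ℝ) : ℂ)) * z).re = -r * z.re := by simp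
  have h4 : ‖((-r : ℝ) : ℂ)‖ ^ 2 = r ^ 2 := by simp
  rw [h3, h4] at h1
  have h5 : 0 ≤ ∑ i, ‖x i‖ ^ 2 := by positivity
  have h6 : 0 < r := by positivity
  have h7 : ‖star d * d + ((-r : ℝ) : ℂ) • 1‖ ^ 2 ≤ r ^ 2 := by gcongr
  nlinarith

end Isometric

open scoped ComplexOrder

/-- The matrix is `d⋆d`, where row `0` of `d` is `f` and the other rows vanish; size `0` has no such
row and is treated apart. -/
theorem CStarMatrix.nonneg_of_star_mul {M : Type*} [CStarAlgebra M] [PartialOrder M]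
    [StarOrderedRing M] {n : ℕ} (f : Fin n → M) :
    0 ≤ (CStarMatrix.ofMatrix (Matrix.of fun i j => star (f i) * f j) :
      CStarMatrix (Fin n) (Fin n) M) := by
  cases n with
  | zero => exact le_of_eq (CStarMatrix.ext fun i => i.elim0)
  | succ n =>
    let d : CStarMatrix (Fin (n + 1)) (Fin (n + 1)) M :=
      CStarMatrix.ofMatrix (Matrix.of fun k j => if k = 0 then f j else 0)
    have hd : CStarMatrix.ofMatrix (Matrix.of fun i j => star (f i) * f j) = star d * d := by
      ext i j
      rw [CStarMatrix.mul_apply, Finset.sum_eq_single 0 (fun k _ hk => ?_) (by simp)]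
      · simp [d, CStarMatrix.star_apply]
      · simp [d, hk]
    rw [hd]
    exact star_mul_self_nonneg d

/-! ### The cone of kernels with positive hermitian part. -/

section Kernel

variable {K : Type*}
variable {A : Type*} [Ring A] [StarRing A] [Algebra ℂ A] [StarModule ℂ A]

/-- The hermitian matrices over `A_p` given by the values of an `A`-valued kernel of finite
support. -/
def kernelMatrix (p : CStarSeminorm A) (v : K × K →₀ A) {n : ℕ} (x : Fin n → K) :
    CStarMatrix (Fin n) (Fin n) p.Alg :=
  CStarMatrix.ofMatrix
    (Matrix.of fun i j => p.toAlg (v (x i, x j)) + star (p.toAlg (v (x j, x i))))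

omit [StarModule ℂ A] in
theorem kernelMatrix_apply (p : CStarSeminorm A) (v : K × K →₀ A) {n : ℕ} (x : Fin n → K)
    (i j : Fin n) : kernelMatrix p v x i j =
      p.toAlg (v (x i, x j)) + star (p.toAlg (v (x j, x i))) := rfl

theorem kernelMatrix_zero (p : CStarSeminorm A) {n : ℕ} (x : Fin n → K) :
    kernelMatrix p 0 x = 0 := by
  ext i j
  rw [kernelMatrix_apply, Finsupp.zero_apply, Finsupp.zero_apply, ← p.coe_toAlgHom, map_zero,
    star_zero, add_zero]
  rfl

omit [StarModule ℂ A] in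
theorem kernelMatrix_add (p : CStarSeminorm A) (v w : K × K →₀ A) {n : ℕ} (x : Fin n → K) :
    kernelMatrix p (v + w) x = kernelMatrix p v x + kernelMatrix p w x := by
  ext i j
  rw [CStarMatrix.add_apply]
  simp only [kernelMatrix_apply, Finsupp.add_apply, p.toAlg_add, star_add]
  abel

theorem kernelMatrix_smul (p : CStarSeminorm A) (c : ℝ) (v : K × K →₀ A) {n : ℕ} (x : Fin n → K) :
    kernelMatrix p (c • v) x = (c : ℂ) • kernelMatrix p v x := by
  ext i j
  rw [CStarMatrix.smul_apply]
  simp only [kernelMatrix_apply, ← Complex.coe_smul, Finsupp.smul_apply, p.toAlg_smul, star_smul,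
    smul_add]
  simp

/-- The cone of kernels with positive hermitian part. -/
def kernelCone (p : CStarSeminorm A) (K : Type*) : PointedCone ℝ (K × K →₀ A) where
  carrier := {v | ∀ (n : ℕ) (x : Fin n → K), 0 ≤ kernelMatrix p v x}
  zero_mem' := fun n x => (kernelMatrix_zero p x).ge
  add_mem' := fun {v w} hv hw n x => by
    rw [kernelMatrix_add]; exact add_nonneg (hv n x) (hw n x)
  smul_mem' := fun c v hv n x => by
    obtain ⟨d, hd⟩ := exists_eq_star_mul_self (hv n x)
    have : kernelMatrix p (c • v) x =
        star (((√(c : ℝ) : ℝ) : ℂ) • d) * (((√(c : ℝ) : ℝ) : ℂ) • d) := by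
      change kernelMatrix p ((c : ℝ) • v) x = _
      rw [kernelMatrix_smul, hd, star_smul, smul_mul_smul_comm]
      congr 1
      rw [Complex.star_def, Complex.conj_ofReal, ← Complex.ofReal_mul, Real.mul_self_sqrt c.2]
    rw [this]
    exact star_mul_self_nonneg _

/-- The kernel `(x, y) ↦ f(x)⋆ g(y)`. -/
def gram (f g : K →₀ A) : K × K →₀ A :=
  Finsupp.onFinset (f.support ×ˢ g.support) (fun xy => star (f xy.1) * g xy.2) fun xy h => by
    rw [Finset.mem_product, Finsupp.mem_support_iff, Finsupp.mem_support_iff]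
    exact ⟨fun h0 => h (by rw [h0, star_zero, zero_mul]), fun h0 => h (by rw [h0, mul_zero])⟩

omit [Algebra ℂ A] [StarModule ℂ A] in
theorem gram_apply (f g : K →₀ A) (x y : K) : gram f g (x, y) = star (f x) * g y := rfl

omit [Algebra ℂ A] [StarModule ℂ A] in
theorem gram_add_left (f g h : K →₀ A) : gram (f + g) h = gram f h + gram g h := by
  ext ⟨x, y⟩
  simp only [gram_apply, Finsupp.add_apply, star_add, add_mul]

omit [Algebra ℂ A] [StarModule ℂ A] in
theorem gram_add_right (f g h : K →₀ A) : gram f (g + h) = gram f g + gram f h := by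
  ext ⟨x, y⟩
  simp only [gram_apply, Finsupp.add_apply, mul_add]

theorem gram_smul_left (c : ℂ) (f g : K →₀ A) : gram (c • f) g = star c • gram f g := by
  ext ⟨x, y⟩
  simp only [gram_apply, Finsupp.smul_apply, star_smul, smul_mul_assoc]

omit [StarModule ℂ A] in
theorem gram_smul_right (c : ℂ) (f g : K →₀ A) : gram f (c • g) = c • gram f g := by
  ext ⟨x, y⟩
  simp only [gram_apply, Finsupp.smul_apply, mul_smul_comm]

omit [Algebra ℂ A] [StarModule ℂ A] in
theorem gram_star_smul (a : A) (f g : K →₀ A) : gram (star a • f) g = gram f (a • g) := by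
  ext ⟨x, y⟩
  simp only [gram_apply, Finsupp.smul_apply, smul_eq_mul, star_mul, star_star, mul_assoc]

theorem gram_single (a b : A) (x y : K) :
    gram (Finsupp.single x a) (Finsupp.single y b) = Finsupp.single (x, y) (star a * b) := by
  classical
  ext ⟨z, w⟩
  rw [gram_apply]
  simp only [Finsupp.single_apply, Prod.mk.injEq]
  by_cases h1 : x = z <;> by_cases h2 : y = w <;> simp [h1, h2]

theorem gram_self_mem_kernelCone (p : CStarSeminorm A) (f : K →₀ A) :
    gram f f ∈ kernelCone p K := fun n x => by
  have h := CStarMatrix.nonneg_of_star_mul fun i => p.toAlg (f (x i))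
  refine (add_nonneg h h).trans_eq ?_
  ext i j
  simp only [CStarMatrix.add_apply, CStarMatrix.ofMatrix_apply, Matrix.of_apply,
    kernelMatrix_apply, gram_apply, p.toAlg_mul, p.toAlg_star, star_mul, star_star]

/-- The hermitian part is zero. Used for `c = ±i`, this forces a functional that is nonnegative on
the cone to take real values on `gram f f`. -/
theorem smul_gram_self_mem_kernelCone (p : CStarSeminorm A) (f : K →₀ A) {c : ℂ} (hc : c.re = 0) :
    c • gram f f ∈ kernelCone p K := fun n x => by
  refine Eq.le ?_
  ext i j
  have : star c = -c := by
    apply Complex.ext <;> simp [hc]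
  simp only [CStarMatrix.zero_apply,
    kernelMatrix_apply, gram_apply, Finsupp.smul_apply, p.toAlg_smul,  p.toAlg_mul, p.toAlg_star,
    star_mul, star_star, star_smul, this, neg_smul, add_neg_cancel]

/-- The kernel is `f(x)⋆(p(a)² - a⋆a)f(y)`, and the middle factor has the form `d⋆d` in `A_p`. This
bounds left multiplication by `a` in the GNS space. -/
theorem sub_gram_smul_mem_kernelCone (p : CStarSeminorm A) (a : A) (f : K →₀ A) :
    (p a ^ 2) • gram f f - gram (a • f) (a • f) ∈ kernelCone p K := fun n x => by
  obtain ⟨d, hd⟩ := exists_star_mul_self_eq_norm_sq_sub (p.toAlg a)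
  have h := CStarMatrix.nonneg_of_star_mul fun i => d * p.toAlg (f (x i))
  refine (add_nonneg h h).trans_eq ?_
  ext i j
  have key : ∀ i j, p.toAlg (((p a ^ 2) • gram f f - gram (a • f) (a • f)) (x i, x j)) =
      star (d * p.toAlg (f (x i))) * (d * p.toAlg (f (x j))) := fun i j => by
    rw [star_mul, mul_assoc, ← mul_assoc (star d), ← hd, p.norm_toAlg, ← Complex.coe_smul,
      Finsupp.sub_apply, Finsupp.smul_apply, gram_apply, gram_apply, Finsupp.smul_apply,
      Finsupp.smul_apply, smul_eq_mul, smul_eq_mul, ← p.coe_toAlgHom, map_sub, map_smul]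
    simp only [p.coe_toAlgHom, p.toAlg_mul, p.toAlg_star, star_mul, sub_mul, mul_sub,
      smul_mul_assoc, one_mul, mul_smul_comm, mul_assoc]
  rw [kernelMatrix_apply, key, key, star_mul (star _), star_star]
  rfl

/-- Kernels with scalar values dominate all others, which is the density condition in the Riesz
theorem. -/
theorem exists_single_add_mem_kernelCone (p : CStarSeminorm A) (a b : K) (z : A) :
    ∃ r : ℝ, r • (Finsupp.single (a, a) 1 + Finsupp.single (b, b) 1) + Finsupp.single (a, b) z ∈
      kernelCone p K := by
  classical
  refine ⟨(1 + p z ^ 2) / 2, fun n x => ?_⟩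
  obtain ⟨d, hd⟩ := exists_star_mul_self_eq_norm_sq_sub (p.toAlg z)
  rw [p.norm_toAlg] at hd
  let U : Fin n → p.Alg := fun i => if a = x i then 1 else 0
  let V : Fin n → p.Alg := fun i => if b = x i then 1 else 0
  -- With `d⋆d = p(z)² - z⋆z` the four Gram matrices add up to `(1 + p(z)²)(UU + VV) + UzV + Vz⋆U`.
  -- The hermitian part doubles the real multiple of the unit kernels, whence the factor `1/2` in
  -- `r`.
  have h := add_nonneg (add_nonneg
    (CStarMatrix.nonneg_of_star_mul fun i => U i + p.toAlg z * V i)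
    (CStarMatrix.nonneg_of_star_mul V))
    (add_nonneg (CStarMatrix.nonneg_of_star_mul fun i => d * V i)
    (CStarMatrix.nonneg_of_star_mul fun i => ((p z : ℝ) : ℂ) • U i))
  refine h.trans_eq ?_
  have hs : ∀ (a b : K) (z : A) (i j : Fin n),
      p.toAlgHom ((Finsupp.single (a, b) z : K × K →₀ A) (x i, x j)) =
        (if a = x i then 1 else 0) * p.toAlgHom z * (if b = x j then 1 else 0) := by
    intro a b z i j
    rw [Finsupp.single_apply]
    by_cases h1 : a = x i <;> by_cases h2 : b = x j <;> simp [h1, h2]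
  have hv : ∀ i j, p.toAlg (((((1 + p z ^ 2) / 2 : ℝ) • (Finsupp.single (a, a) 1 +
      Finsupp.single (b, b) 1) + Finsupp.single (a, b) z : K × K →₀ A)) (x i, x j)) =
      (((1 + p z ^ 2) / 2 : ℝ) : ℂ) • (U i * U j + V i * V j) + U i * p.toAlg z * V j :=
    fun i j => by
      rw [← Complex.coe_smul, ← p.coe_toAlgHom, Finsupp.add_apply, Finsupp.smul_apply,
        Finsupp.add_apply, map_add, map_smul, map_add, hs, hs, hs, map_one, mul_one, mul_one]
      rfl
  have hU : ∀ i, star (U i) = U i := fun i => by simp only [U]; split_ifs <;> simp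
  have hV : ∀ i, star (V i) = V i := fun i => by simp only [V]; split_ifs <;> simp
  ext i j
  rw [kernelMatrix_apply, hv, hv]
  have h1 : star (d * V i) * (d * V j) = ((p z ^ 2 : ℝ) : ℂ) • (V i * V j) -
      V i * star (p.toAlg z) * p.toAlg z * V j := by
    rw [star_mul, mul_assoc, ← mul_assoc (star d), ← hd, hV]
    simp only [sub_mul, mul_sub, smul_mul_assoc, mul_smul_comm, one_mul, mul_assoc]
  have hUU : U j * U i = U i * U j := by simp only [U]; split_ifs <;> simp
  have hVV : V j * V i = V i * V j := by simp only [V]; split_ifs <;> simp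
  simp only [CStarMatrix.add_apply, CStarMatrix.ofMatrix_apply, Matrix.of_apply, h1]
  simp only [star_add, star_mul, star_smul, hU, hV, add_mul, mul_add, smul_mul_smul_comm,
    ← mul_assoc, hUU, hVV, Complex.star_def, Complex.conj_ofReal, smul_add]
  push_cast
  module

end Kernel

/-! ### Extension of functionals on kernels. -/

section Extension

variable {W : Type*} [AddCommGroup W] [Module ℂ W]
variable {K : Type*} [NormedAddCommGroup K] [InnerProductSpace ℂ K]

/-- The functional on kernels associated with a linear map into `B(K)`. -/
def kernelFunctional (Φ : W →ₗ[ℂ] (K →L[ℂ] K)) : (K × K →₀ W) →ₗ[ℂ] ℂ :=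
  Finsupp.lsum ℂ fun xy => (innerSL ℂ xy.1 : K →ₗ[ℂ] ℂ) ∘ₗ
    (ContinuousLinearMap.apply ℂ K xy.2 : (K →L[ℂ] K) →ₗ[ℂ] K) ∘ₗ Φ

theorem kernelFunctional_single (Φ : W →ₗ[ℂ] (K →L[ℂ] K)) (x y : K) (w : W) :
    kernelFunctional Φ (Finsupp.single (x, y) w) = ⟪x, Φ w y⟫_ℂ := by
  rw [kernelFunctional, Finsupp.lsum_single]
  rfl

theorem exists_kernelFunctional_eq_sum (Φ : W →ₗ[ℂ] (K →L[ℂ] K)) (w : K × K →₀ W) :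
    ∃ (n : ℕ) (x : Fin n → K), 
      kernelFunctional Φ w = ∑ i, ∑ j, ⟪x i, Φ (w (x i, x j)) (x j)⟫_ℂ := by
  classical
  set T : Finset K := w.support.image Prod.fst ∪ w.support.image Prod.snd
  -- The points are listed without repetition, so that each value of `w` is counted once.
  refine ⟨T.card, fun i => (T.equivFin.symm i : K), ?_⟩
  have h1 : kernelFunctional Φ w = ∑ xy ∈ T ×ˢ T, ⟪xy.1, Φ (w xy) xy.2⟫_ℂ := by
    rw [kernelFunctional, Finsupp.lsum_apply]
    refine Finsupp.sum_of_support_subset _ (fun xy h => ?_) _ (by simp)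
    exact Finset.mem_product.2 ⟨Finset.mem_union_left _ (Finset.mem_image_of_mem _ h),
      Finset.mem_union_right _ (Finset.mem_image_of_mem _ h)⟩
  rw [h1, Finset.sum_product, ← Finset.sum_coe_sort T, ← Equiv.sum_comp T.equivFin.symm]
  refine Finset.sum_congr rfl fun i _ => ?_
  rw [← Finset.sum_coe_sort T, ← Equiv.sum_comp T.equivFin.symm]

variable {A : Type*} [Ring A] [StarRing A] [Algebra ℂ A] [StarModule ℂ A]
variable {B : Type*} [Ring B] [StarRing B] [Algebra ℂ B] [StarModule ℂ B]
variable [CompleteSpace K]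
variable {p : CStarSeminorm A} {q : CStarSeminorm B} {j₁ : W →ₗ[ℂ] A} {j₂ : W →ₗ[ℂ] B}
variable {τ : B →⋆ₐ[ℂ] (K →L[ℂ] K)}

/-- A version of the Arveson extension theorem, for functionals on kernels. -/
theorem IsUnitalIsometricPair.exists_extension (hj : IsUnitalIsometricPair p q j₁ j₂)
    (hstar : ∀ w, ∃ w', j₁ w' = star (j₁ w)) (hτ : ∀ b, ‖τ b‖ ≤ q b) :
    ∃ F : (K × K →₀ A) →ₗ[ℂ] ℂ, (∀ w x y, F (Finsupp.single (x, y) (j₁ w)) = ⟪x, τ (j₂ w) y⟫_ℂ) ∧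
      ∀ v ∈ kernelCone p K, 0 ≤ (F v).re := by
  choose σ hσ using hstar
  set s := kernelFunctional ((τ : B →ₗ[ℂ] (K →L[ℂ] K)) ∘ₗ j₂) with hs
  let J : (K × K →₀ W) →ₗ[ℂ] (K × K →₀ A) := Finsupp.mapRange.linearMap j₁
  have hJ : ∀ w xy, J w xy = j₁ (w xy) := fun w xy => rfl
  let J' : (K × K →₀ W) →ₗ[ℝ] (K × K →₀ A) := J.restrictScalars ℝ
  let g : (K × K →₀ W) →ₗ[ℝ] ℝ := Complex.reLm ∘ₗ s.restrictScalars ℝ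
  obtain ⟨G, hG, hpos⟩ := exists_positive_extension (kernelCone p K) J' g (fun w hw => by
      obtain ⟨n, x, hx⟩ := exists_kernelFunctional_eq_sum
        ((τ : B →ₗ[ℂ] (K →L[ℂ] K)) ∘ₗ j₂) w
      change 0 ≤ (s w).re
      rw [hs, hx]
      have h1 := hj.re_nonneg hτ (Matrix.of fun i j => w (x i, x j) + σ (w (x j, x i))) x (by
        refine (hw n x).trans_eq ?_
        ext i j
        simp only [kernelMatrix_apply, CStarMatrix.ofMatrix_apply, Matrix.map_apply,
          Matrix.of_apply, map_add, hσ, p.toAlg_add, p.toAlg_star]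
        rfl)
      have h2 := hj.im_eq_zero hτ
        (Matrix.of fun i j => Complex.I • (w (x i, x j) - σ (w (x j, x i)))) x (fun i j => by
          simp only [Matrix.of_apply, map_smul, map_sub, hσ, star_smul, star_sub, star_star,
            Complex.star_def, Complex.conj_I, neg_smul, ← smul_neg, neg_sub])
      simp only [Matrix.of_apply, map_smul, map_sub, map_add, _root_.add_apply, _root_.sub_apply,
        _root_.smul_apply, inner_add_right, inner_sub_right, inner_smul_right,
        Finset.sum_add_distrib, ← Finset.mul_sum, Finset.sum_sub_distrib, Complex.add_re,
        Complex.I_mul_im, Complex.sub_re] at h1 h2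
      simp only [LinearMap.comp_apply]
      change 0 ≤ (∑ i, ∑ j, ⟪x i, τ (j₂ (w (x i, x j))) (x j)⟫_ℂ).re
      linarith) (fun y => by
      obtain ⟨e, he, -⟩ := hj.exists_one
      induction y using Finsupp.induction_linear with
      | zero => exact ⟨0, by rw [map_zero, add_zero]; exact (kernelCone p K).zero_mem⟩
      | add y z hy hz =>
        obtain ⟨v, hv⟩ := hy
        obtain ⟨w, hw⟩ := hz
        refine ⟨v + w, ?_⟩
        rw [map_add, add_add_add_comm]
        exact (kernelCone p K).add_mem hv hw
      | single ab z =>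
        obtain ⟨r, hr⟩ := exists_single_add_mem_kernelCone p ab.1 ab.2 z
        refine ⟨r • (Finsupp.single (ab.1, ab.1) e + Finsupp.single (ab.2, ab.2) e), ?_⟩
        rw [map_smul, map_add]
        convert hr using 5 <;>
        · change J _ = _
          simp [J, he])
  -- The Riesz theorem gives a real functional; `F(v) = G(v) - iG(iv)` is the complex-linear
  -- functional with real part `G`.
  refine ⟨Module.Dual.extendRCLike G, fun w x y => ?_, fun v hv => ?_⟩
  · have h1 : J' (Finsupp.single (x, y) w) = Finsupp.single (x, y) (j₁ w) := by
      change J _ = _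
      simp [J]
    have h2 : Module.Dual.extendRCLike G (J (Finsupp.single (x, y) w)) =
        s (Finsupp.single (x, y) w) := by
      rw [Module.Dual.extendRCLike_apply, ← map_smul]
      change ((G (J' _) : ℝ) : ℂ) - Complex.I * ((G (J' (Complex.I • _)) : ℝ) : ℂ) = _
      rw [hG, hG]
      change (((s _).re : ℝ) : ℂ) - Complex.I * (((s (Complex.I • _)).re : ℝ) : ℂ) = _
      rw [map_smul]
      apply Complex.ext <;> simp
    rw [← h1]
    exact h2.trans (kernelFunctional_single _ x y w)
  · exact (hpos v hv).trans_eq (Module.Dual.re_extendRCLike_apply (𝕜 := ℂ) G v).symm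

end Extension

-- The GNS and Stinespring constructions.

universe u w

/-- A contractive `⋆`-representation by operators on a pre-Hilbert space extends to its
completion. -/
theorem exists_completion_representation {A : Type*} [Ring A] [StarRing A] [Algebra ℂ A]
    (p : CStarSeminorm A) {X : Type*} [SeminormedAddCommGroup X] [InnerProductSpace ℂ X]
    (ρ : A →ₐ[ℂ] Module.End ℂ X) (hstar : ∀ a f g, ⟪ρ (star a) f, g⟫_ℂ = ⟪f, ρ a g⟫_ℂ)
    (hle : ∀ a f, ‖ρ a f‖ ≤ p a * ‖f‖) :
    ∃ σ : A →⋆ₐ[ℂ] (UniformSpace.Completion X →L[ℂ] UniformSpace.Completion X),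
      (∀ a, ‖σ a‖ ≤ p a) ∧ ∀ a (f : X), σ a f = (ρ a f : X) := by
  let R : A → X →L[ℂ] X := fun a => (ρ a).mkContinuous (p a) (hle a)
  have hR : ∀ a (f : X), (R a).completion f = (ρ a f : X) :=
    fun a f => (R a).completion_apply_coe f
  have hext : ∀ {S T : UniformSpace.Completion X →L[ℂ] UniformSpace.Completion X},
      (∀ f : X, S f = T f) → S = T := fun {S T} h => by
    ext x
    exact UniformSpace.Completion.induction_on x (isClosed_eq S.continuous T.continuous) h
  let σ : A →⋆ₐ[ℂ] (UniformSpace.Completion X →L[ℂ] UniformSpace.Completion X) :=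
    { toFun := fun a => (R a).completion
      map_one' := hext fun f => by rw [hR, map_one]; rfl
      map_mul' := fun a b => hext fun f => by
        rw [_root_.mul_apply_eq_comp, hR, hR, hR, map_mul]; rfl
      map_zero' := hext fun f => by
        rw [hR, map_zero]; exact UniformSpace.Completion.coe_zero
      map_add' := fun a b => hext fun f => by
        rw [_root_.add_apply, hR, hR, hR, map_add]; exact UniformSpace.Completion.coe_add _ _
      commutes' := fun r => hext fun f => by
        rw [hR, AlgHom.commutes]; exact UniformSpace.Completion.coe_smul _ _
      map_star' := fun a => by
        rw [ContinuousLinearMap.star_eq_adjoint, ContinuousLinearMap.eq_adjoint_iff]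
        intro x y
        refine UniformSpace.Completion.induction_on₂ x y (isClosed_eq
          (((R _).completion.continuous.comp continuous_fst).inner continuous_snd)
          (continuous_fst.inner ((R _).completion.continuous.comp continuous_snd))) fun f g => ?_
        rw [hR, hR, UniformSpace.Completion.inner_coe, UniformSpace.Completion.inner_coe, hstar] }
  refine ⟨σ, fun a => ContinuousLinearMap.opNorm_le_bound _ (apply_nonneg p.toSeminorm a)
    fun x => ?_, hR⟩
  refine UniformSpace.Completion.induction_on x
    (isClosed_le (by fun_prop) (by fun_prop)) fun f => ?_
  change ‖(R a).completion f‖ ≤ _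
  rw [hR, UniformSpace.Completion.norm_coe, UniformSpace.Completion.norm_coe]
  exact hle a f

/-- A representation on a space with a positive semidefinite form gives a representation on a
Hilbert space. -/
theorem exists_representation_of_core {A : Type*} [Ring A] [StarRing A] [Algebra ℂ A]
    (p : CStarSeminorm A) {X : Type u} [AddCommGroup X] [Module ℂ X]
    (core : PreInnerProductSpace.Core ℂ X) (ρ : A →ₐ[ℂ] Module.End ℂ X)
    (hstar : ∀ a f g, core.inner (ρ (star a) f) g = core.inner f (ρ a g))
    (hle : ∀ a f, (core.inner (ρ a f) (ρ a f)).re ≤ p a ^ 2 * (core.inner f f).re) :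
    ∃ (L : Type u) (_ : NormedAddCommGroup L) (_ : InnerProductSpace ℂ L)
      (_ : CompleteSpace L) (ι : X → L) (σ : A →⋆ₐ[ℂ] (L →L[ℂ] L)),
      (∀ a, ‖σ a‖ ≤ p a) ∧ (∀ f g, ⟪ι f, ι g⟫_ℂ = core.inner f g) ∧
      ∀ a f, σ a (ι f) = ι (ρ a f) := by
  let : SeminormedAddCommGroup X := InnerProductSpace.Core.toSeminormedAddCommGroup (c := core)
  let : InnerProductSpace ℂ X := InnerProductSpace.ofCore core
  obtain ⟨σ, hσ, hσ'⟩ := exists_completion_representation p ρ hstar (fun a f => by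
    refine le_of_sq_le_sq ?_ (mul_nonneg (apply_nonneg p.toSeminorm a) (norm_nonneg f))
    rw [mul_pow, ← inner_self_eq_norm_sq (𝕜 := ℂ), ← inner_self_eq_norm_sq (𝕜 := ℂ)]
    exact hle a f)
  exact ⟨UniformSpace.Completion X, inferInstance, inferInstance, inferInstance,
    fun f => (f : UniformSpace.Completion X), σ, hσ,
    fun f g => UniformSpace.Completion.inner_coe f g, hσ'⟩

/-- A map that preserves inner products is linear. -/
theorem exists_linearIsometry {K L : Type*} [NormedAddCommGroup K] [InnerProductSpace ℂ K]
    [NormedAddCommGroup L] [InnerProductSpace ℂ L] (v : K → L)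
    (hv : ∀ x y, ⟪v x, v y⟫_ℂ = ⟪x, y⟫_ℂ) : ∃ V : K →ₗᵢ[ℂ] L, ∀ x, V x = v x := by
  let V : K →ₗ[ℂ] L :=
    { toFun := v
      map_add' := fun x y => by
        rw [← sub_eq_zero, ← inner_self_eq_zero (𝕜 := ℂ)]
        simp only [inner_sub_left, inner_sub_right, inner_add_left, inner_add_right, hv]
        ring
      map_smul' := fun c x => by
        rw [← sub_eq_zero, ← inner_self_eq_zero (𝕜 := ℂ)]
        simp only [inner_sub_left, inner_sub_right, inner_smul_left, inner_smul_right, hv,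
          RingHom.id_apply]
        ring }
  exact ⟨V.isometryOfInner hv, fun x => rfl⟩

variable {A : Type u} [Ring A] [StarRing A] [Algebra ℂ A] [StarModule ℂ A]
variable {K : Type w} [NormedAddCommGroup K] [InnerProductSpace ℂ K]

/-- The Stinespring construction for a positive functional on kernels. -/
theorem exists_stinespring (p : CStarSeminorm A) (F : (K × K →₀ A) →ₗ[ℂ] ℂ)
    (hpos : ∀ f, 0 ≤ F (gram f f))
    (hbd : ∀ a f, (F (gram (a • f) (a • f))).re ≤ p a ^ 2 * (F (gram f f)).re)
    (hone : ∀ x y, F (Finsupp.single (x, y) 1) = ⟪x, y⟫_ℂ) :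
    ∃ (L : Type (max u w)) (_ : NormedAddCommGroup L) (_ : InnerProductSpace ℂ L)
      (_ : CompleteSpace L) (V : K →ₗᵢ[ℂ] L) (σ : A →⋆ₐ[ℂ] (L →L[ℂ] L)),
      (∀ a, ‖σ a‖ ≤ p a) ∧ ∀ a x y, ⟪V x, σ a (V y)⟫_ℂ = F (Finsupp.single (x, y) a) := by
  have him : ∀ f, (F (gram f f)).im = 0 := fun f => (Complex.nonneg_iff.1 (hpos f)).2.symm
  let core : PreInnerProductSpace.Core ℂ (K →₀ A) :=
    { inner := fun f g => F (gram f g)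
      conj_inner_symm := fun f g => by
        -- Polarization: reality of the form on the diagonal at `f + g` and `f + ig` gives hermitian
        -- symmetry.
        have h1 := him (f + g)
        have h2 := him (f + Complex.I • g)
        simp only [gram_add_left, gram_add_right, gram_smul_left, gram_smul_right, map_add,
          map_smul, Complex.add_im, Complex.add_re, smul_eq_mul, Complex.star_def, Complex.conj_I, Complex.mul_im,
          Complex.I_re, Complex.I_im, Complex.neg_re, Complex.neg_im, Complex.mul_re, him] at h1 h2
        apply Complex.ext
        · rw [Complex.conj_re]; linarith
        · rw [Complex.conj_im]; linarith
      re_inner_nonneg := fun f => (Complex.nonneg_iff.1 (hpos f)).1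
      add_left := fun f g h => by rw [gram_add_left, map_add]
      smul_left := fun f g r => by rw [gram_smul_left, map_smul]; rfl }
  have hinner : ∀ f g : K →₀ A, core.inner f g = F (gram f g) := fun f g => rfl
  obtain ⟨L, i₁, i₂, i₃, ι, σ, hσ, hι, hσι⟩ := exists_representation_of_core p core
    (Algebra.lsmul ℂ ℂ (K →₀ A) : A →ₐ[ℂ] Module.End ℂ (K →₀ A))
    (fun a f g => congrArg F (gram_star_smul a f g)) hbd
  -- In `K →₀ A` the space `K` is only an index set. Linearity of `x ↦ δ_x` in the Hilbert space
  -- comes from preservation of inner products, that is, from `hone`.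
  obtain ⟨V, hV⟩ := exists_linearIsometry (K := K) (fun x => ι (Finsupp.single x 1))
    (fun x y => by rw [hι, hinner, gram_single, star_one, one_mul, hone])
  refine ⟨L, i₁, i₂, i₃, V, σ, hσ, fun a x y => ?_⟩
  rw [hV, hV, hσι, hι, hinner, Algebra.lsmul_coe]
  change F (gram _ (a • Finsupp.single y 1)) = _
  rw [Finsupp.smul_single, gram_single, star_one, one_mul, smul_eq_mul, mul_one]

section Dilation

variable {B : Type*} [Ring B] [StarRing B] [Algebra ℂ B] [StarModule ℂ B]
variable {W : Type*} [AddCommGroup W] [Module ℂ W] [CompleteSpace K]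
variable {p : CStarSeminorm A} {q : CStarSeminorm B} {j₁ : W →ₗ[ℂ] A} {j₂ : W →ₗ[ℂ] B}
variable {τ : B →⋆ₐ[ℂ] (K →L[ℂ] K)}

/-- A representation of `B` can be dilated to a representation of `A` along an isometric pair. -/
theorem IsUnitalIsometricPair.exists_dilation (hj : IsUnitalIsometricPair p q j₁ j₂)
    (hstar : ∀ w, ∃ w', j₁ w' = star (j₁ w)) (hτ : ∀ b, ‖τ b‖ ≤ q b) :
    ∃ (L : Type (max u w)) (_ : NormedAddCommGroup L) (_ : InnerProductSpace ℂ L)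
      (_ : CompleteSpace L) (V : K →ₗᵢ[ℂ] L) (σ : A →⋆ₐ[ℂ] (L →L[ℂ] L)),
      (∀ a, ‖σ a‖ ≤ p a) ∧ ∀ w x y, ⟪V x, σ (j₁ w) (V y)⟫_ℂ = ⟪x, τ (j₂ w) y⟫_ℂ := by
  obtain ⟨F, hF, hcone⟩ := hj.exists_extension hstar hτ
  obtain ⟨e, he₁, he₂⟩ := hj.exists_one
  obtain ⟨L, i₁, i₂, i₃, V, σ, hσ, hV⟩ := exists_stinespring p F
    (fun f => by
      have h1 := hcone _ (gram_self_mem_kernelCone p f)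
      have h2 := hcone _ (smul_gram_self_mem_kernelCone p f (c := Complex.I) (by simp))
      have h3 := hcone _ (smul_gram_self_mem_kernelCone p f (c := -Complex.I) (by simp))
      simp only [map_smul, smul_eq_mul, neg_mul, Complex.neg_re, Complex.I_mul_re] at h2 h3
      exact Complex.nonneg_iff.2 ⟨h1, by linarith⟩)
    (fun a f => by
      have h := hcone _ (sub_gram_smul_mem_kernelCone p a f)
      rw [← Complex.coe_smul, map_sub, map_smul, smul_eq_mul, Complex.sub_re,
        Complex.re_ofReal_mul] at h
      linarith)
    (fun x y => by rw [← he₁, hF, he₂, map_one]; rfl)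
  exact ⟨L, i₁, i₂, i₃, V, σ, hσ, fun w x y => (hV _ _ _).trans (hF _ _ _)⟩

end Dilation

/-! ### Functional calculus in a Fréchet locally C⋆-algebra. -/

open Filter Topology

section FunctionalCalculus

variable {A : Type*} [Ring A] [StarRing A] [Algebra ℂ A] [StarModule ℂ A]

omit [StarModule ℂ A] in
theorem CStarSeminorm.norm_one (p : CStarSeminorm A) : ‖(1 : p.Alg)‖ = 1 := by
  rw [← p.toAlg_one, p.norm_toAlg]
  exact p.map_one'

instance (p : CStarSeminorm A) : NormOneClass p.Alg := ⟨p.norm_one⟩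

variable [UniformSpace A] {Γ : ℕ → CStarSeminorm A}

omit [StarModule ℂ A] in
theorem IsFrechetLocallyCStarAlgebra.continuous (hA : IsFrechetLocallyCStarAlgebra Γ) (m : ℕ) :
    Continuous (Γ m) := by
  have := hA.isUniformAddGroup
  exact hA.withSeminorms.continuous_seminorm m

/-- The continuous functional calculus of a Fréchet locally C⋆-algebra. -/
theorem IsFrechetLocallyCStarAlgebra.exists_cfc (hA : IsFrechetLocallyCStarAlgebra Γ) {h : A}
    (hh : IsSelfAdjoint h) {f : ℝ → ℝ} (hf : Continuous f) :
    ∃ d : A, ∀ m, (Γ m).toAlg d = cfc f ((Γ m).toAlg h) := by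
  have := hA.isUniformAddGroup
  have := hA.completeSpace
  -- The spectra of `h` in the algebras `A_m` need not lie in one bounded interval, so the intervals
  -- of approximation grow with `k`.
  have hP : ∀ k : ℕ, ∃ P : Polynomial ℝ, ∀ x ∈ Set.Icc (-(k : ℝ)) k,
      |P.eval x - f x| < 1 / ((k : ℝ) + 1) := fun k =>
    exists_polynomial_near_of_continuousOn _ _ f hf.continuousOn _ (by positivity)
  choose P hP using hP
  let u : ℕ → A := fun k => Polynomial.aeval h (P k)
  have hsa : ∀ m, IsSelfAdjoint ((Γ m).toAlg h) := fun m => by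
    rw [IsSelfAdjoint, ← (Γ m).toAlg_star, hh.star_eq]
  have hu : ∀ m k, (Γ m).toAlg (u k) = cfc (P k).eval ((Γ m).toAlg h) := fun m k => by
    rw [cfc_polynomial _ _ (hsa m)]
    exact (Polynomial.aeval_algHom_apply ((Γ m).toAlgHom.toAlgHom.restrictScalars ℝ) h (P k)).symm
  have hlim : ∀ m, Tendsto (fun k => (Γ m).toAlg (u k)) atTop (𝓝 (cfc f ((Γ m).toAlg h))) :=
    fun m => by
      rw [tendsto_iff_norm_sub_tendsto_zero]
      refine squeeze_zero' (Eventually.of_forall fun k => norm_nonneg _) ?_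
        tendsto_one_div_add_atTop_nhds_zero_nat
      -- From here on `[-k, k]` contains the spectrum of `h` in `A_m`.
      filter_upwards [eventually_ge_atTop ⌈Γ m h⌉₊] with k hk
      have := hsa m
      rw [hu, ← cfc_sub _ _ _ (by fun_prop) hf.continuousOn]
      refine norm_cfc_le (by positivity) fun x hx => (hP k x (abs_le.1 ?_)).le
      have h1 := spectrum.norm_le_norm_of_mem hx
      rw [(Γ m).norm_toAlg] at h1
      exact h1.trans (Nat.ceil_le.1 hk)
  have hcauchy : CauchySeq u := by
    rw [cauchySeq_iff_tendsto, uniformity_eq_comap_nhds_zero A, tendsto_comap_iff,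
      hA.withSeminorms.tendsto_nhds]
    intro m ε hε
    have h1 := (hlim m).cauchySeq
    rw [cauchySeq_iff_tendsto, Metric.uniformity_eq_comap_nhds_zero, tendsto_comap_iff] at h1
    filter_upwards [h1.eventually (gt_mem_nhds hε)] with kl hkl
    rw [sub_zero]
    simp only [Function.comp_apply, Prod.map] at hkl ⊢
    rw [← (Γ m).norm_toAlg, ← (Γ m).coe_toAlgHom, map_sub, ← dist_eq_norm, dist_comm]
    exact hkl
  obtain ⟨d, hd⟩ := cauchySeq_tendsto_of_complete hcauchy
  refine ⟨d, fun m => tendsto_nhds_unique ?_ (hlim m)⟩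
  rw [tendsto_iff_norm_sub_tendsto_zero]
  have h1 : Tendsto (fun k => Γ m (u k - d)) atTop (𝓝 (Γ m (d - d))) :=
    ((hA.continuous m).tendsto _).comp (hd.sub_const d)
  rw [sub_self, map_zero] at h1
  refine h1.congr fun k => ?_
  rw [← (Γ m).norm_toAlg, ← (Γ m).coe_toAlgHom, map_sub]
  rfl

/-- Take `d = √(r + h)`. The spectrum of `h` in `A_m` lies in `[-r, r]`, so squaring returns `r + h`
there; at other levels `r + h` need not be positive, hence equality only modulo `p_m`. -/
theorem IsFrechetLocallyCStarAlgebra.exists_add_eq_star_mul_self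
    (hA : IsFrechetLocallyCStarAlgebra Γ) (m : ℕ) {h : A} (hh : IsSelfAdjoint h) {r : ℝ}
    (hr : Γ m h ≤ r) :
    ∃ d : A, Γ m ((r : ℂ) • 1 + h - star d * d) = 0 := by
  obtain ⟨d, hd⟩ := hA.exists_cfc hh (f := fun x => √(r + x)) (by fun_prop)
  refine ⟨d, ?_⟩
  set a := (Γ m).toAlg h with ha
  have hsa : IsSelfAdjoint a := by
    rw [IsSelfAdjoint, ← (Γ m).toAlg_star, hh.star_eq]
  have h1 : star ((Γ m).toAlg d) * (Γ m).toAlg d = (r : ℂ) • 1 + a := by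
    have h2 : IsSelfAdjoint (cfc (fun x : ℝ => √(r + x)) a) := cfc_predicate _ _
    rw [hd, h2.star_eq, ← cfc_mul _ _ _ (by fun_prop) (by fun_prop)]
    have h3 : cfc (fun x : ℝ => √(r + x) * √(r + x)) a = cfc (fun x : ℝ => r + x) a := by
      refine cfc_congr fun x hx => Real.mul_self_sqrt ?_
      have h4 := spectrum.norm_le_norm_of_mem hx
      rw [(Γ m).norm_toAlg] at h4
      have := neg_le_of_abs_le (h4.trans hr)
      linarith
    rw [h3, cfc_const_add r (fun x => x) a, cfc_id' ℝ a, Algebra.algebraMap_eq_smul_one,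
      Complex.coe_smul]
  rw [← CStarSeminorm.toAlg_eq_zero, ← CStarSeminorm.coe_toAlgHom, map_sub, map_add, map_smul,
    map_one, map_mul, map_star, CStarSeminorm.coe_toAlgHom, CStarSeminorm.coe_toAlgHom, h1, sub_self]

end FunctionalCalculus

/-! ### Compressions of representations. -/

section Compression

variable {A : Type*} [Ring A] [StarRing A] [Algebra ℂ A]
variable {K : Type*} [NormedAddCommGroup K] [InnerProductSpace ℂ K] [CompleteSpace K]
variable {L : Type*} [NormedAddCommGroup L] [InnerProductSpace ℂ L] [CompleteSpace L]

/-- The compression `a ↦ V⋆ σ(a) V` of a representation. -/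
def compression (σ : A →⋆ₐ[ℂ] (L →L[ℂ] L)) (V : K →ₗᵢ[ℂ] L) : A →ₗ[ℂ] (K →L[ℂ] K) where
  toFun a := V.toContinuousLinearMap.adjoint ∘L σ a ∘L V.toContinuousLinearMap
  map_add' a b := by ext x; simp
  map_smul' c a := by ext x; simp

theorem inner_compression (σ : A →⋆ₐ[ℂ] (L →L[ℂ] L)) (V : K →ₗᵢ[ℂ] L) (a : A) (x y : K) :
    ⟪x, compression σ V a y⟫_ℂ = ⟪V x, σ a (V y)⟫_ℂ := by
  change ⟪x, V.toContinuousLinearMap.adjoint (σ a (V y))⟫_ℂ = _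
  rw [ContinuousLinearMap.adjoint_inner_right]
  rfl

theorem eq_compression {σ : A →⋆ₐ[ℂ] (L →L[ℂ] L)} {V : K →ₗᵢ[ℂ] L} {T : K →L[ℂ] K} {a : A}
    (h : ∀ x y, ⟪V x, σ a (V y)⟫_ℂ = ⟪x, T y⟫_ℂ) : compression σ V a = T := by
  ext y
  exact ext_inner_left ℂ fun x => (inner_compression σ V a x y).trans (h x y)

theorem compression_one (σ : A →⋆ₐ[ℂ] (L →L[ℂ] L)) (V : K →ₗᵢ[ℂ] L) : compression σ V 1 = 1 :=
  eq_compression fun x y => by rw [map_one]; exact V.inner_map_map x y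

theorem norm_compression_le (σ : A →⋆ₐ[ℂ] (L →L[ℂ] L)) (V : K →ₗᵢ[ℂ] L) (a : A) :
    ‖compression σ V a‖ ≤ ‖σ a‖ := by
  have hV : ‖V.toContinuousLinearMap‖ ≤ 1 := V.norm_toContinuousLinearMap_le
  have hV' : ‖V.toContinuousLinearMap.adjoint‖ ≤ 1 := by
    rwa [LinearIsometryEquiv.norm_map]
  calc ‖compression σ V a‖
      ≤ ‖V.toContinuousLinearMap.adjoint‖ * (‖σ a‖ * ‖V.toContinuousLinearMap‖) :=
        (ContinuousLinearMap.opNorm_comp_le _ _).trans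
          (by gcongr; exact ContinuousLinearMap.opNorm_comp_le _ _)
    _ ≤ 1 * (‖σ a‖ * 1) := by gcongr
    _ = ‖σ a‖ := by ring

/-- A compression that is a representation is a restriction to a reducing subspace. -/
theorem map_eq_of_compression {σ : A →⋆ₐ[ℂ] (L →L[ℂ] L)} {V : K →ₗᵢ[ℂ] L}
    (hmul : ∀ a b, compression σ V (a * b) = compression σ V a * compression σ V b)
    (hstar : ∀ a, compression σ V (star a) = star (compression σ V a)) (a : A) (x : K) :
    σ a (V x) = V (compression σ V a x) := by
  have h1 : ⟪V (compression σ V a x), σ a (V x)⟫_ℂ =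
      ⟪compression σ V a x, compression σ V a x⟫_ℂ := (inner_compression σ V a _ x).symm
  have h2 : ⟪σ a (V x), σ a (V x)⟫_ℂ = ⟪compression σ V a x, compression σ V a x⟫_ℂ := by
    rw [← ContinuousLinearMap.adjoint_inner_right, ← ContinuousLinearMap.star_eq_adjoint,
      ← map_star, ← _root_.mul_apply_eq_comp, ← map_mul, ← inner_compression, hmul, hstar,
      _root_.mul_apply_eq_comp, ContinuousLinearMap.star_eq_adjoint,
      ContinuousLinearMap.adjoint_inner_right]
  have h3 : ⟪σ a (V x), V (compression σ V a x)⟫_ℂ =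
      ⟪compression σ V a x, compression σ V a x⟫_ℂ := by
    rw [← inner_conj_symm, h1, inner_conj_symm]
  -- The four inner products in `‖σ(a)Vx - V(V⋆σ(a)Vx)‖²` coincide and cancel.
  rw [← sub_eq_zero, ← inner_self_eq_zero (𝕜 := ℂ), inner_sub_left, inner_sub_right,
    inner_sub_right, h1, h2, h3, V.inner_map_map]
  ring

theorem compression_star (σ : A →⋆ₐ[ℂ] (L →L[ℂ] L)) (V : K →ₗᵢ[ℂ] L) (a : A) :
    compression σ V (star a) = star (compression σ V a) :=
  eq_compression fun x y => by
    rw [ContinuousLinearMap.star_eq_adjoint, ContinuousLinearMap.adjoint_inner_right,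
      ← inner_conj_symm (compression σ V a x), inner_compression, inner_conj_symm,
      StarHomClass.map_star, ContinuousLinearMap.star_eq_adjoint,
      ContinuousLinearMap.adjoint_inner_right]

theorem apply_compression {σ : A →⋆ₐ[ℂ] (L →L[ℂ] L)} {V : K →ₗᵢ[ℂ] L}
    (h : ∀ a x, ∃ y, V y = σ a (V x)) (a : A) (x : K) :
    V (compression σ V a x) = σ a (V x) := by
  obtain ⟨y, hy⟩ := h a x
  have : compression σ V a x = y := ext_inner_left ℂ fun z => by
    rw [inner_compression, ← hy, V.inner_map_map]
  rw [this, hy]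

theorem compression_mul {σ : A →⋆ₐ[ℂ] (L →L[ℂ] L)} {V : K →ₗᵢ[ℂ] L}
    (h : ∀ a x, ∃ y, V y = σ a (V x)) (a b : A) :
    compression σ V (a * b) = compression σ V a * compression σ V b := by
  ext x
  apply V.injective
  rw [apply_compression h, map_mul, _root_.mul_apply_eq_comp, _root_.mul_apply_eq_comp,
    apply_compression h, apply_compression h]

end Compression

/-! ### Completely positive maps and their Stinespring dilations. -/

section CompletelyPositive

theorem inner_matOp {K : Type*} [NormedAddCommGroup K] [InnerProductSpace ℂ K] {n : ℕ}
    (T : Matrix (Fin n) (Fin n) (K →L[ℂ] K)) (X Y : PiLp 2 fun _ : Fin n => K) :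
    ⟪X, matOp T Y⟫_ℂ = ∑ i, ∑ j, ⟪X i, T i j (Y j)⟫_ℂ := by
  rw [PiLp.inner_apply]
  refine Finset.sum_congr rfl fun i _ => ?_
  rw [← inner_sum]
  congr 1
  change (∑ j, T i j ∘L ContinuousLinearMap.proj j : (Fin n → K) →L[ℂ] K) _ = _
  rw [_root_.sum_apply]
  rfl

variable {A : Type u} [Ring A] [StarRing A] [Algebra ℂ A] [StarModule ℂ A]
variable {K : Type w} [NormedAddCommGroup K] [InnerProductSpace ℂ K]
variable {p : CStarSeminorm A} {φ : A →ₗ[ℂ] (K →L[ℂ] K)}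

theorem CStarSeminorm.isNull_iff {n : ℕ} {c : Matrix (Fin n) (Fin n) A} :
    p.IsNull c ↔ ∀ i j, p (c i j) = 0 := by
  rw [CStarSeminorm.IsNull, CStarSeminorm.matSeminorm, norm_eq_zero]
  refine ⟨fun h i j => ?_, fun h => ?_⟩
  · exact CStarSeminorm.toAlg_eq_zero.1
      (congrArg (fun M : CStarMatrix (Fin n) (Fin n) p.Alg => M i j) h)
  · ext i j
    exact CStarSeminorm.toAlg_eq_zero.2 (h i j)

theorem IsCPFor.nonneg (hφ : IsCPFor p φ) {n : ℕ} (g : Fin n → A) (c : Matrix (Fin n) (Fin n) A)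
    (hc : ∀ i j, p (c i j) = 0) (x : Fin n → K) :
    0 ≤ ∑ i, ∑ j, ⟪x i, φ (star (g i) * g j + c i j) (x j)⟫_ℂ := by
  cases n with
  | zero => simp
  | succ n =>
    have hpos : p.IsPos (Matrix.of fun i j => star (g i) * g j + c i j) := by
      refine ⟨Matrix.of fun k j => if k = 0 then g j else 0, c, ?_, CStarSeminorm.isNull_iff.2 hc⟩
      ext i j
      rw [Matrix.add_apply, Matrix.mul_apply, Finset.sum_eq_single 0 (fun k _ hk => ?_) (by simp)]
      · simp
      · simp [hk]
    have := ((hφ _ _).1 hpos).inner_nonneg_right (WithLp.toLp 2 x)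
    rwa [inner_matOp] at this

/-- `IsCPFor` tests positivity only on `b⋆b + c` with entries in `A` itself, not in `A_p`. The root
of `p(a)² - a⋆a` is therefore taken in `A`, up to a null remainder. -/
theorem IsCPFor.exists_stinespring [UniformSpace A] {Γ : ℕ → CStarSeminorm A}
    (hA : IsFrechetLocallyCStarAlgebra Γ) {m : ℕ} (hφ : IsCPFor (Γ m) φ) (hone : φ 1 = 1) :
    ∃ (L : Type (max u w)) (_ : NormedAddCommGroup L) (_ : InnerProductSpace ℂ L)
      (_ : CompleteSpace L) (V : K →ₗᵢ[ℂ] L) (σ : A →⋆ₐ[ℂ] (L →L[ℂ] L)),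
      (∀ a, ‖σ a‖ ≤ Γ m a) ∧ ∀ a x y, ⟪V x, σ a (V y)⟫_ℂ = ⟪x, φ a y⟫_ℂ := by
  obtain ⟨L, i₁, i₂, i₃, V, σ, hσ, hV⟩ := LocalCStar.exists_stinespring (Γ m) (kernelFunctional φ)
    (fun f => by
      obtain ⟨n, x, hx⟩ := exists_kernelFunctional_eq_sum φ (gram f f)
      have := hφ.nonneg (fun i => f (x i)) 0 (fun i j => map_zero (Γ m).toSeminorm) x
      simp only [Matrix.zero_apply, add_zero] at this
      rw [hx]
      exact this)
    (fun a f => by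
      have ha : Γ m (-(star a * a)) ≤ Γ m a ^ 2 := by
        rw [map_neg_eq_map]; exact ((Γ m).map_star_mul_self' a).le
      obtain ⟨d, hd⟩ := hA.exists_add_eq_star_mul_self m (IsSelfAdjoint.star_mul_self a).neg ha
      obtain ⟨n, x, hx⟩ := exists_kernelFunctional_eq_sum φ
        (((Γ m a ^ 2 : ℝ) : ℂ) • gram f f - gram (a • f) (a • f))
      -- The remainder `z` is null, and so is every `f(x)⋆ z f(y)`; these entries form the matrix
      -- `c` in the definition of positivity.
      set z := ((Γ m a ^ 2 : ℝ) : ℂ) • (1 : A) + -(star a * a) - star d * d with hz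
      have h0 : ∀ i j, Γ m (star (f (x i)) * z * f (x j)) = 0 := fun i j => by
        rw [← CStarSeminorm.toAlg_eq_zero] at hd ⊢
        rw [CStarSeminorm.toAlg_mul, CStarSeminorm.toAlg_mul, hd, mul_zero, zero_mul]
      have h1 := hφ.nonneg (fun i => d * f (x i))
        (Matrix.of fun i j => star (f (x i)) * z * f (x j)) h0 x
      have h2 : ∀ i j, star (d * f (x i)) * (d * f (x j)) + star (f (x i)) * z * f (x j) =
          (((Γ m a ^ 2 : ℝ) : ℂ) • gram f f - gram (a • f) (a • f)) (x i, x j) := fun i j => by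
        rw [Finsupp.sub_apply, Finsupp.smul_apply, gram_apply, gram_apply, Finsupp.smul_apply,
          Finsupp.smul_apply, hz]
        simp only [smul_eq_mul, star_mul, mul_add, add_mul, mul_sub, sub_mul, mul_smul_comm,
          smul_mul_assoc, mul_one, mul_neg, neg_mul, mul_assoc]
        abel
      simp only [Matrix.of_apply, h2] at h1
      rw [← hx, map_sub, map_smul, smul_eq_mul] at h1
      have h3 := (Complex.nonneg_iff.1 h1).1
      rw [Complex.sub_re, Complex.re_ofReal_mul] at h3
      linarith)
    (fun x y => by rw [kernelFunctional_single, hone]; rfl)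
  exact ⟨L, i₁, i₂, i₃, V, σ, hσ, fun a x y => (hV a x y).trans (kernelFunctional_single φ x y a)⟩

variable [CompleteSpace K]
variable {L : Type*} [NormedAddCommGroup L] [InnerProductSpace ℂ L] [CompleteSpace L]

theorem isCPFor_compression {σ : A →⋆ₐ[ℂ] (L →L[ℂ] L)} (hσ : ∀ a, ‖σ a‖ ≤ p a)
    (V : K →ₗᵢ[ℂ] L) : IsCPFor p (compression σ V) := by
  have hnull : ∀ {a}, p a = 0 → σ a = 0 := fun {a} ha =>
    norm_le_zero_iff.1 ((hσ a).trans ha.le)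
  have hsum : ∀ {n : ℕ} (a : Matrix (Fin n) (Fin n) A) (X : PiLp 2 fun _ : Fin n => K),
      ⟪X, matOp (a.map (compression σ V)) X⟫_ℂ = ∑ i, ∑ j, ⟪V (X i), σ (a i j) (V (X j))⟫_ℂ :=
    fun a X => by
      rw [inner_matOp]
      simp only [Matrix.map_apply, inner_compression]
  refine fun n a => ⟨?_, fun h => ?_⟩
  · rintro ⟨b, c, rfl, hc⟩
    rw [CStarSeminorm.isNull_iff] at hc
    rw [← ContinuousLinearMap.isPositive_toLinearMap_iff, LinearMap.isPositive_iff_complex]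
    intro X
    have h1 : ⟪X, matOp ((bᴴ * b + c).map (compression σ V)) X⟫_ℂ =
        ((∑ k, ‖∑ j, σ (b k j) (V (X j))‖ ^ 2 : ℝ) : ℂ) := by
      rw [hsum, ← sum_inner_star_mul (fun k i => σ (b k i)) fun i => V (X i)]
      refine Finset.sum_congr rfl fun i _ => Finset.sum_congr rfl fun j _ => ?_
      rw [Matrix.add_apply, map_add, hnull (hc i j), add_zero, Matrix.mul_apply, map_sum]
      simp only [Matrix.conjTranspose_apply, map_mul, map_star]
    have h2 : ⟪matOp ((bᴴ * b + c).map (compression σ V)) X, X⟫_ℂ =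
        ((∑ k, ‖∑ j, σ (b k j) (V (X j))‖ ^ 2 : ℝ) : ℂ) := by
      rw [← inner_conj_symm, h1, Complex.conj_ofReal]
    have h3 : 0 ≤ ∑ k, ‖∑ j, σ (b k j) (V (X j))‖ ^ 2 := by positivity
    rw [ContinuousLinearMap.coe_coe, h2]
    exact ⟨rfl, h3⟩
  · rw [CStarSeminorm.isNull_iff] at h
    ext X : 1
    refine ext_inner_left ℂ fun Y => ?_
    rw [inner_matOp, _root_.zero_apply, inner_zero_right]
    refine Finset.sum_eq_zero fun i _ => Finset.sum_eq_zero fun j _ => ?_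
    rw [Matrix.map_apply, inner_compression, hnull (h i j), _root_.zero_apply, inner_zero_right]

end CompletelyPositive

/-! ### Continuity and determination by a generating subspace. -/

section Generators

variable {A : Type*} [Ring A] [StarRing A] [Algebra ℂ A] [StarModule ℂ A]
variable {K : Type*} [NormedAddCommGroup K] [InnerProductSpace ℂ K] [CompleteSpace K]
variable {S : Submodule ℂ A}

omit [CompleteSpace K] in
theorem Generates.invariant [TopologicalSpace A] (hgen : Generates S)
    (hS : IsLocalOperatorSystem S) {σ : A →ₗ[ℂ] (K →L[ℂ] K)}
    (hmul : ∀ a b, σ (a * b) = σ a * σ b) (hcont : Continuous σ) {M : Submodule ℂ K}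
    (hM : IsClosed (M : Set K)) (hinv : ∀ s ∈ S, ∀ x ∈ M, σ s x ∈ M) (a : A) :
    ∀ x ∈ M, σ a x ∈ M := by
  -- The statement for `a` and `a⋆` jointly survives the involution step of the induction, although
  -- `M` need not be reducing and `σ` need not preserve adjoints.
  have hadj : ∀ a ∈ StarAlgebra.adjoin ℂ (S : Set A),
      (∀ x ∈ M, σ a x ∈ M) ∧ ∀ x ∈ M, σ (star a) x ∈ M := fun a ha => by
    induction ha using StarAlgebra.adjoin_induction with
    | mem s hs => exact ⟨hinv s hs, hinv _ (hS.star_mem s hs)⟩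
    | algebraMap r =>
      have h : ∀ c : ℂ, ∀ x ∈ M, σ (algebraMap ℂ A c) x ∈ M := fun c x hx => by
        rw [Algebra.algebraMap_eq_smul_one, map_smul]
        exact M.smul_mem c (hinv 1 hS.one_mem x hx)
      refine ⟨h r, ?_⟩
      rw [← algebraMap_star_comm]
      exact h _
    | add a b _ _ ha hb =>
      refine ⟨fun x hx => ?_, fun x hx => ?_⟩
      · rw [map_add]; exact M.add_mem (ha.1 x hx) (hb.1 x hx)
      · rw [star_add, map_add]; exact M.add_mem (ha.2 x hx) (hb.2 x hx)
    | mul a b _ _ ha hb =>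
      refine ⟨fun x hx => ?_, fun x hx => ?_⟩
      · rw [hmul]; exact ha.1 _ (hb.1 x hx)
      · rw [star_mul, hmul]; exact hb.2 _ (ha.2 x hx)
    | star a _ ha => exact ⟨ha.2, by rw [star_star]; exact ha.1⟩
  intro x hx
  have hcl : IsClosed {a : A | σ a x ∈ M} :=
    hM.preimage ((ContinuousLinearMap.apply ℂ K x).continuous.comp hcont)
  have hsub : (StarAlgebra.adjoin ℂ (S : Set A) : Set A) ⊆ {a : A | σ a x ∈ M} :=
    fun a ha => (hadj a ha).1 x hx
  have := hcl.closure_subset_iff.2 hsub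
  rw [hgen] at this
  exact this (Set.mem_univ a)

omit [CompleteSpace K] in
theorem Generates.ext [TopologicalSpace A] (hgen : Generates S)
    (hS : IsLocalOperatorSystem S) {σ ρ : A →ₗ[ℂ] (K →L[ℂ] K)}
    (hσ : ∀ a b, σ (a * b) = σ a * σ b) (hσc : Continuous σ)
    (hρ : ∀ a b, ρ (a * b) = ρ a * ρ b) (hρc : Continuous ρ) (h : ∀ s ∈ S, σ s = ρ s) :
    σ = ρ := by
  have hadj : ∀ a ∈ StarAlgebra.adjoin ℂ (S : Set A),
      σ a = ρ a ∧ σ (star a) = ρ (star a) := fun a ha => by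
    induction ha using StarAlgebra.adjoin_induction with
    | mem s hs => exact ⟨h s hs, h _ (hS.star_mem s hs)⟩
    | algebraMap r =>
      have h' : ∀ c : ℂ, σ (algebraMap ℂ A c) = ρ (algebraMap ℂ A c) := fun c => by
        rw [Algebra.algebraMap_eq_smul_one, map_smul, map_smul, h 1 hS.one_mem]
      exact ⟨h' r, by rw [← algebraMap_star_comm]; exact h' _⟩
    | add a b _ _ ha hb =>
      exact ⟨by rw [map_add, map_add, ha.1, hb.1],
        by rw [star_add, map_add, map_add, ha.2, hb.2]⟩
    | mul a b _ _ ha hb =>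
      exact ⟨by rw [hσ, hρ, ha.1, hb.1], by rw [star_mul, hσ, hρ, ha.2, hb.2]⟩
    | star a _ ha => exact ⟨ha.2, by rw [star_star]; exact ha.1⟩
  have hsub : (StarAlgebra.adjoin ℂ (S : Set A) : Set A) ⊆ {a : A | σ a = ρ a} :=
    fun a ha => (hadj a ha).1
  have := (isClosed_eq hσc hρc).closure_subset_iff.2 hsub
  rw [hgen] at this
  exact LinearMap.ext fun a => this (Set.mem_univ a)

variable [UniformSpace A] {Γ : ℕ → CStarSeminorm A}

omit [CompleteSpace K] in
theorem IsFrechetLocallyCStarAlgebra.continuous_of_le (hA : IsFrechetLocallyCStarAlgebra Γ)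
    {m : ℕ} {σ : A →ₗ[ℂ] (K →L[ℂ] K)} (hσ : ∀ a, ‖σ a‖ ≤ Γ m a) : Continuous σ := by
  have := hA.isUniformAddGroup
  refine continuous_iff_continuousAt.2 fun a => tendsto_iff_norm_sub_tendsto_zero.2 ?_
  have h1 : Tendsto (fun b => Γ m (b - a)) (𝓝 a) (𝓝 (Γ m (a - a))) :=
    (((hA.continuous m).comp (continuous_id.sub continuous_const)).tendsto a)
  rw [sub_self, map_zero] at h1
  exact squeeze_zero (fun b => norm_nonneg _) (fun b => by rw [← map_sub]; exact hσ _) h1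

theorem IsCPFor.norm_le (hA : IsFrechetLocallyCStarAlgebra Γ) {m : ℕ}
    {φ : A →ₗ[ℂ] (K →L[ℂ] K)} (hφ : IsCPFor (Γ m) φ) (hone : φ 1 = 1) (a : A) :
    ‖φ a‖ ≤ Γ m a := by
  obtain ⟨L, _, _, _, V, σ, hσ, hV⟩ := hφ.exists_stinespring hA hone
  rw [← eq_compression (hV a)]
  exact (norm_compression_le σ V a).trans (hσ a)

end Generators

/-! ### Transfer of a single boundary representation. -/

section Transfer

variable {A₁ : Type*} [Ring A₁] [StarRing A₁] [Algebra ℂ A₁] [StarModule ℂ A₁]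
variable {A₂ : Type*} [Ring A₂] [StarRing A₂] [Algebra ℂ A₂] [StarModule ℂ A₂]
variable {S₁ : Submodule ℂ A₁} {S₂ : Submodule ℂ A₂} {φ : S₁ →ₗ[ℂ] S₂}
variable {K : Type*} [NormedAddCommGroup K] [InnerProductSpace ℂ K] [CompleteSpace K]

/-- A compression of a representation of `A₂` that agrees on `S₁` with a boundary representation of
`A₁` is trivial on `S₂`. -/
theorem IsBoundaryRep.apply_eq_of_compression [TopologicalSpace A₁] {p : CStarSeminorm A₁}
    {q : CStarSeminorm A₂} (hS₁ : IsLocalOperatorSystem S₁)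
    (hφ : IsUnitalIsometricPair p q S₁.subtype (S₂.subtype ∘ₗ φ))
    {ρ : A₁ →ₗ[ℂ] (K →L[ℂ] K)} (hρ : IsBoundaryRep p S₁ ρ)
    {L : Type*} [NormedAddCommGroup L] [InnerProductSpace ℂ L] [CompleteSpace L]
    {σ : A₂ →⋆ₐ[ℂ] (L →L[ℂ] L)} (hσ : ∀ b, ‖σ b‖ ≤ q b) {V : K →ₗᵢ[ℂ] L}
    (hV : ∀ s, compression σ V (φ s) = ρ s) (s : S₁) (x : K) :
    σ (φ s) (V x) = V (ρ s x) := by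
  obtain ⟨L', _, _, _, V', θ, hθ, hV'⟩ := hφ.exists_dilation
    (fun w => ⟨⟨star (w : A₁), hS₁.star_mem _ w.2⟩, rfl⟩) hσ
  -- The unique extension property is applied to the compression of the second dilation `θ`, along
  -- `K → L → L'`.
  have hcomp : compression θ (V'.comp V) = ρ :=
    hρ.unique _ (compression_one _ _) (isCPFor_compression hθ _) fun s hs =>
      eq_compression fun x y => by
        rw [← hV ⟨s, hs⟩, inner_compression]
        exact hV' ⟨s, hs⟩ (V x) (V y)
  have key := map_eq_of_compression (σ := θ) (V := V'.comp V)
    (by rw [hcomp]; exact hρ.irreducibleRep.map_mul)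
    (by rw [hcomp]; exact hρ.irreducibleRep.map_star)
  rw [hcomp] at key
  -- Since `θ(s)` maps the copy of `x` in `L'` to that of `ρ(s)x`, which lies in the image of `L`,
  -- compressing back to `L` loses nothing.
  refine ext_inner_left ℂ fun y => ?_
  have h1 := hV' s y (V x)
  have h2 : θ s (V' (V x)) = V' (V (ρ s x)) := key s x
  rw [Submodule.subtype_apply, h2, V'.inner_map_map] at h1
  exact h1.symm

/-- Boundary representations are transferred by unital complete isometries between generating
operator systems. -/
theorem IsBoundaryRep.exists_transfer [UniformSpace A₁] [UniformSpace A₂]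
    {Γ₁ : ℕ → CStarSeminorm A₁} (hA₁ : IsFrechetLocallyCStarAlgebra Γ₁)
    {Γ₂ : ℕ → CStarSeminorm A₂} (hA₂ : IsFrechetLocallyCStarAlgebra Γ₂)
    (hS₁ : IsLocalOperatorSystem S₁) (hgen₁ : Generates S₁)
    (hS₂ : IsLocalOperatorSystem S₂) (hgen₂ : Generates S₂)
    (hsurj : Function.Surjective φ) {m : ℕ}
    (hφ : IsUnitalIsometricPair (Γ₁ m) (Γ₂ m) S₁.subtype (S₂.subtype ∘ₗ φ))
    {ρ : A₁ →ₗ[ℂ] (K →L[ℂ] K)} (hρ : IsBoundaryRep (Γ₁ m) S₁ ρ) :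
    ∃ ψ : A₂ →ₗ[ℂ] (K →L[ℂ] K), IsBoundaryRep (Γ₂ m) S₂ ψ ∧ (∀ s, ψ (φ s) = ρ s) ∧
      ∀ b, ‖ψ b‖ ≤ Γ₂ m b := by
  let τ : A₁ →⋆ₐ[ℂ] (K →L[ℂ] K) :=
    { toFun := ρ
      map_one' := hρ.map_one
      map_mul' := hρ.irreducibleRep.map_mul
      map_zero' := map_zero ρ
      map_add' := map_add ρ
      commutes' := fun r => by
        rw [Algebra.algebraMap_eq_smul_one, map_smul, hρ.map_one, Algebra.algebraMap_eq_smul_one]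
      map_star' := hρ.irreducibleRep.map_star }
  -- Needed for two dilations: that of `ρ`, which gives existence, and that of a competing
  -- extension, which gives uniqueness.
  have hmulcomp : ∀ {L : Type _} [NormedAddCommGroup L] [InnerProductSpace ℂ L] [CompleteSpace L]
      {σ : A₂ →⋆ₐ[ℂ] (L →L[ℂ] L)} {V : K →ₗᵢ[ℂ] L}, (∀ b, ‖σ b‖ ≤ Γ₂ m b) →
      (∀ s, compression σ V (φ s) = ρ s) →
      ∀ a b, compression σ V (a * b) = compression σ V a * compression σ V b := by
    intro L _ _ _ σ V hσ hV
    refine compression_mul fun a x => ?_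
    have hM : IsClosed (LinearMap.range V.toLinearMap : Set L) := by
      rw [LinearMap.coe_range]
      exact V.isometry.isClosedEmbedding.isClosed_range
    exact hgen₂.invariant hS₂ (σ := (σ : A₂ →ₗ[ℂ] (L →L[ℂ] L))) (map_mul σ)
      (hA₂.continuous_of_le (m := m) hσ) hM (fun s hs x hx => by
        obtain ⟨s, rfl⟩ : ∃ s', (φ s' : A₂) = s := (hsurj ⟨s, hs⟩).imp fun s' h => by rw [h]
        obtain ⟨x, rfl⟩ := hx
        exact ⟨ρ s x, (hρ.apply_eq_of_compression hS₁ hφ hσ hV s x).symm⟩) a (V x) ⟨x, rfl⟩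
  -- With `S₁` as common parameter space, reversing the direction only swaps the two maps, and no
  -- inverse of `φ` is needed.
  have hφ' : IsUnitalIsometricPair (Γ₂ m) (Γ₁ m) (S₂.subtype ∘ₗ φ) S₁.subtype :=
    ⟨hφ.exists_one.imp fun e he => he.symm, fun n a => (hφ.isometric n a).symm⟩
  obtain ⟨L, _, _, _, V, σ, hσ, hV⟩ := hφ'.exists_dilation (τ := τ)
    (fun w => (hsurj ⟨star (φ w : A₂), hS₂.star_mem _ (φ w).2⟩).imp fun w' hw' =>
      congrArg Subtype.val hw') (hρ.cp.norm_le hA₁ hρ.map_one)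
  have hext : ∀ s, compression σ V (φ s) = ρ s := fun s => eq_compression (hV s)
  have hle : ∀ b, ‖compression σ V b‖ ≤ Γ₂ m b := fun b => (norm_compression_le σ V b).trans (hσ b)
  refine ⟨compression σ V, ⟨⟨hmulcomp hσ hext, compression_star σ V, hA₂.continuous_of_le hle,
    hρ.irreducibleRep.nontrivial, fun M hM hinv => ?_⟩, compression_one σ V,
    isCPFor_compression hσ V, fun ψ hψ_one hψ_cp hψ => ?_⟩, hext, hle⟩
  -- On `S₁` the operators of `ρ` are among those of the new representation, and `S₁` generates, so
  -- invariance of `M` passes to all of `ρ(A₁)`.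
  · refine hρ.irreducibleRep.irreducible M hM (hgen₁.invariant hS₁ hρ.irreducibleRep.map_mul
      hρ.irreducibleRep.continuous hM fun s hs x hx => ?_)
    rw [← hext ⟨s, hs⟩]
    exact hinv _ x hx
  · obtain ⟨L', _, _, _, V', σ', hσ', hV'⟩ := hψ_cp.exists_stinespring hA₂ hψ_one
    have hψ' : compression σ' V' = ψ := LinearMap.ext fun b => eq_compression (hV' b)
    have hψ_mul := hmulcomp hσ' (V := V') fun s => by rw [hψ', hψ _ (φ s).2, hext]
    rw [hψ'] at hψ_mul
    exact hgen₂.ext hS₂ hψ_mul (hA₂.continuous_of_le (hψ_cp.norm_le hA₂ hψ_one))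
      (hmulcomp hσ hext) (hA₂.continuous_of_le hle) hψ

end Transfer

/-! ### Block decomposition of `C⋆_E(D)`. -/

section Blocks

variable {H : Type*} [NormedAddCommGroup H] [InnerProductSpace ℂ H] [CompleteSpace H]
variable (E : QuantizedDomain H)

/-- The orthogonal projection onto the block `K_m`. -/
def QuantizedDomain.proj (m : ℕ) : H →L[ℂ] E.block m := (E.block m).orthogonalProjectionOnto

variable {E}

omit [CompleteSpace H] in
theorem QuantizedDomain.block_le_orthogonal {m k : ℕ} (h : m < k) :
    E.block k ≤ (E.level m)ᗮ := by
  obtain ⟨k, rfl⟩ := Nat.exists_eq_add_of_lt h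
  exact inf_le_left.trans (Submodule.orthogonal_le (E.mono (by omega)))

theorem QuantizedDomain.proj_coe (m : ℕ) (x : E.block m) : E.proj m x = x :=
  Submodule.orthogonalProjectionOnto_mem_subspace_eq_self x

theorem QuantizedDomain.proj_eq_zero_of_mem_orthogonal {m : ℕ} {x : H} (hx : x ∈ (E.block m)ᗮ) :
    E.proj m x = 0 :=
  Submodule.orthogonalProjectionOnto_eq_zero_iff.2 hx

theorem QuantizedDomain.proj_eq_zero_of_mem_level {m k : ℕ} (h : m < k) {x : H}
    (hx : x ∈ E.level m) : E.proj k x = 0 :=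
  proj_eq_zero_of_mem_orthogonal <| (Submodule.mem_orthogonal' _ _).2 fun _ hu =>
    Submodule.inner_right_of_mem_orthogonal hx (block_le_orthogonal h hu)

theorem QuantizedDomain.proj_eq_zero_of_mem_level_orthogonal {m k : ℕ} (h : k ≤ m) {x : H}
    (hx : x ∈ (E.level m)ᗮ) : E.proj k x = 0 :=
  proj_eq_zero_of_mem_orthogonal
    (Submodule.orthogonal_le ((E.block_le_level k).trans (E.mono h)) hx)

theorem QuantizedDomain.proj_coe_of_ne {k m : ℕ} (h : k ≠ m) (x : E.block m) :
    E.proj k x = 0 := by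
  rcases lt_or_gt_of_ne h with h | h
  · exact proj_eq_zero_of_mem_level_orthogonal le_rfl (block_le_orthogonal h x.2)
  · exact proj_eq_zero_of_mem_level h (E.block_le_level m x.2)

/-- Induction on the level: the part of `x` orthogonal to `H_m` lies in block `m + 1`, and the part
in `H_m` has the same coordinates as `x` up to `m`. Thus vectors of `D` have finitely many nonzero
coordinates. -/
theorem QuantizedDomain.sum_proj : ∀ {m : ℕ} {x : H}, x ∈ E.level m →
    ∑ k ∈ Finset.range (m + 1), (E.proj k x : H) = x
  | 0, x, hx => by
    rw [Finset.sum_range_one]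
    exact congrArg Subtype.val (E.proj_coe 0 ⟨x, hx⟩)
  | m + 1, x, hx => by
    set u := (E.level m).starProjection x with hu
    have hum : u ∈ E.level m := Submodule.starProjection_apply_mem _ _
    have hperp : x - u ∈ (E.level m)ᗮ := Submodule.sub_starProjection_mem_orthogonal _
    have hblock : x - u ∈ E.block (m + 1) :=
      ⟨hperp, (E.level (m + 1)).sub_mem hx (E.mono (Nat.le_succ m) hum)⟩
    have h1 : (E.proj (m + 1) x : H) = x - u := by
      have h2 : E.proj (m + 1) x = E.proj (m + 1) (x - u) := by
        rw [map_sub, E.proj_eq_zero_of_mem_level (Nat.lt_succ_self m) hum, sub_zero]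
      rw [h2]
      exact congrArg Subtype.val (E.proj_coe (m + 1) ⟨x - u, hblock⟩)
    have h3 : ∀ k ∈ Finset.range (m + 1), (E.proj k x : H) = E.proj k u := fun k hk => by
      rw [← sub_eq_zero, ← Submodule.coe_sub, ← map_sub,
        E.proj_eq_zero_of_mem_level_orthogonal (Nat.lt_succ_iff.1 (Finset.mem_range.1 hk)) hperp]
      rfl
    rw [Finset.sum_range_succ, h1, Finset.sum_congr rfl h3, sum_proj hum]
    abel

theorem QuantizedDomain.mem_level_of_proj_eq_zero {m : ℕ} (x : E.domain)
    (h : ∀ k, m < k → E.proj k x = 0) : (x : H) ∈ E.level m := by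
  obtain ⟨l, hl⟩ := E.exists_level x
  rw [← E.sum_proj hl]
  refine Submodule.sum_mem _ fun k _ => ?_
  rcases le_or_gt k m with hk | hk
  · exact E.mono hk (E.block_le_level k (E.proj k x).2)
  · rw [h k hk]; exact Submodule.zero_mem _

theorem QuantizedDomain.mem_orthogonal_of_proj_eq_zero {m : ℕ} (x : E.domain)
    (h : ∀ k, k ≤ m → E.proj k x = 0) : (x : H) ∈ (E.level m)ᗮ := by
  obtain ⟨l, hl⟩ := E.exists_level x
  rw [← E.sum_proj hl]
  refine Submodule.sum_mem _ fun k _ => ?_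
  rcases le_or_gt k m with hk | hk
  · rw [h k hk]; exact Submodule.zero_mem _
  · exact block_le_orthogonal hk (E.proj k x).2

theorem QuantizedDomain.ext_proj {x y : E.domain} (h : ∀ k, E.proj k x = E.proj k y) : x = y := by
  obtain ⟨l, hl⟩ := E.exists_level (x - y)
  rw [← sub_eq_zero]
  refine Subtype.ext ?_
  rw [← E.sum_proj hl]
  refine Finset.sum_eq_zero fun k _ => ?_
  rw [Submodule.coe_sub, map_sub, h, sub_self]
  rfl

theorem QuantizedDomain.inner_eq_sum {m : ℕ} {x : H} (hx : x ∈ E.level m) (y : H) :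
    ⟪x, y⟫_ℂ = ∑ k ∈ Finset.range (m + 1), ⟪E.proj k x, E.proj k y⟫_ℂ := by
  conv_lhs => rw [← E.sum_proj hx, sum_inner]
  refine Finset.sum_congr rfl fun k _ => ?_
  exact (Submodule.inner_orthogonalProjectionOnto_eq_of_mem_left (E.proj k x) y).symm

theorem QuantizedDomain.norm_sq_eq_sum {m : ℕ} {x : H} (hx : x ∈ E.level m) :
    ‖x‖ ^ 2 = ∑ k ∈ Finset.range (m + 1), ‖E.proj k x‖ ^ 2 := by
  rw [← inner_self_eq_norm_sq (𝕜 := ℂ), E.inner_eq_sum hx, map_sum]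
  simp only [inner_self_eq_norm_sq]

/-- The coordinates of `S x` are those of `x` acted on by the blocks of `S`. -/
theorem proj_apply (S : CStarE E) (k : ℕ) (x : E.domain) :
    E.proj k (S.1 x) = onBlock E k S (E.proj k x) := by
  obtain ⟨m, hm⟩ := E.exists_level x
  let y : ℕ → E.domain := fun j => ⟨E.proj j x, E.level_le j (E.block_le_level j (E.proj j x).2)⟩
  have hx : x = ∑ j ∈ Finset.range (m + 1), y j := Subtype.ext <| by
    rw [Submodule.coe_sum]
    exact (E.sum_proj hm).symm
  have hSx : E.proj k (S.1 x) =
      ∑ j ∈ Finset.range (m + 1), E.proj k (onBlock E j S (E.proj j x) : H) := by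
    conv_lhs => rw [hx, map_sum, Submodule.coe_sum, map_sum]
    rfl
  rw [hSx]
  -- `S` keeps every block, so only the summand `j = k` can survive; for `k > m` both sides vanish.
  by_cases hk : k ∈ Finset.range (m + 1)
  · rw [Finset.sum_eq_single_of_mem k hk fun j _ hj => E.proj_coe_of_ne hj.symm _, E.proj_coe]
  · rw [E.proj_eq_zero_of_mem_level (by simpa using hk) hm, map_zero]
    exact Finset.sum_eq_zero fun j hj => E.proj_coe_of_ne (by rintro rfl; exact hk hj) _

theorem cstarE_ext {S T : CStarE E}
    (h : ∀ (x : E.domain) (k : ℕ), E.proj k (S.1 x) = E.proj k (T.1 x)) : S = T :=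
  Subtype.ext <| LinearMap.ext fun x => E.ext_proj fun k => h x k

theorem exists_diagonal (T : ∀ k, E.block k →L[ℂ] E.block k) (x : E.domain) :
    ∃ y : E.domain, ∀ k, E.proj k y = T k (E.proj k x) := by
  obtain ⟨m, hm⟩ := E.exists_level x
  refine ⟨⟨∑ j ∈ Finset.range (m + 1), (T j (E.proj j x) : H), Submodule.sum_mem _ fun j _ =>
    E.level_le j (E.block_le_level j (T j (E.proj j x)).2)⟩, fun k => ?_⟩
  change E.proj k (∑ j ∈ Finset.range (m + 1), (T j (E.proj j x) : H)) = _
  rw [map_sum]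
  by_cases hk : k ∈ Finset.range (m + 1)
  · rw [Finset.sum_eq_single_of_mem k hk fun j _ hj => E.proj_coe_of_ne hj.symm _, E.proj_coe]
  · rw [E.proj_eq_zero_of_mem_level (by simpa using hk) hm, map_zero]
    exact Finset.sum_eq_zero fun j hj => E.proj_coe_of_ne (by rintro rfl; exact hk hj) _

/-- The operator on `D` with prescribed blocks. -/
def diagonalEnd (T : ∀ k, E.block k →L[ℂ] E.block k) : Module.End ℂ E.domain where
  toFun x := (exists_diagonal T x).choose
  map_add' x y := E.ext_proj fun k => by
    rw [(exists_diagonal T _).choose_spec, Submodule.coe_add, Submodule.coe_add, map_add, map_add,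
      map_add, (exists_diagonal T _).choose_spec, (exists_diagonal T _).choose_spec]
  map_smul' c x := E.ext_proj fun k => by
    rw [(exists_diagonal T _).choose_spec, RingHom.id_apply, Submodule.coe_smul,
      Submodule.coe_smul, map_smul, map_smul, map_smul, (exists_diagonal T _).choose_spec]

theorem proj_diagonalEnd (T : ∀ k, E.block k →L[ℂ] E.block k) (x : E.domain) (k : ℕ) :
    E.proj k (diagonalEnd T x) = T k (E.proj k x) :=
  (exists_diagonal T x).choose_spec k

theorem diagonalEnd_mem_level (T : ∀ k, E.block k →L[ℂ] E.block k) {m : ℕ} {x : E.domain}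
    (hx : (x : H) ∈ E.level m) : (diagonalEnd T x : H) ∈ E.level m :=
  E.mem_level_of_proj_eq_zero _ fun k hk => by
    rw [proj_diagonalEnd, E.proj_eq_zero_of_mem_level hk hx, map_zero]

/-- Pythagoras over the blocks `0, …, m`, whose orthogonal sum is `H_m`. -/
theorem norm_diagonalEnd_le (T : ∀ k, E.block k →L[ℂ] E.block k) {m : ℕ} {C : ℝ} (hC : 0 ≤ C)
    (hT : ∀ k, k ≤ m → ‖T k‖ ≤ C) {x : E.domain} (hx : (x : H) ∈ E.level m) :
    ‖diagonalEnd T x‖ ≤ C * ‖x‖ := by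
  refine le_of_sq_le_sq ?_ (by positivity)
  change ‖(diagonalEnd T x : H)‖ ^ 2 ≤ (C * ‖(x : H)‖) ^ 2
  rw [mul_pow, E.norm_sq_eq_sum (diagonalEnd_mem_level T hx), E.norm_sq_eq_sum hx, Finset.mul_sum]
  refine Finset.sum_le_sum fun k hk => ?_
  rw [proj_diagonalEnd, ← mul_pow]
  have := hT k (Nat.lt_succ_iff.1 (Finset.mem_range.1 hk))
  exact pow_le_pow_left₀ (norm_nonneg _) ((T k).le_of_opNorm_le this _) 2

theorem isCStarE_diagonalEnd (T : ∀ k, E.block k →L[ℂ] E.block k) :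
    IsCStarE E (diagonalEnd T) where
  mem_level _ _ hx := diagonalEnd_mem_level T hx
  mem_orthogonal _ _ hx := E.mem_orthogonal_of_proj_eq_zero _ fun k hk => by
    rw [proj_diagonalEnd, E.proj_eq_zero_of_mem_level_orthogonal hk hx, map_zero]
  bounded m := ⟨∑ k ∈ Finset.range (m + 1), ‖T k‖, fun x hx => by
    refine norm_diagonalEnd_le T (Finset.sum_nonneg fun k _ => norm_nonneg (T k)) (fun k hk => ?_) hx
    exact Finset.single_le_sum (f := fun k => ‖T k‖) (fun k _ => norm_nonneg (T k))
      (Finset.mem_range.2 (Nat.lt_succ_iff.2 hk))⟩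

/-- The element of `C⋆_E(D)` with prescribed blocks. -/
def diagonal (T : ∀ k, E.block k →L[ℂ] E.block k) : CStarE E :=
  ⟨diagonalEnd T, isCStarE_diagonalEnd T⟩

theorem coe_diagonal (T : ∀ k, E.block k →L[ℂ] E.block k) : (diagonal T).1 = diagonalEnd T := rfl

theorem proj_diagonal (T : ∀ k, E.block k →L[ℂ] E.block k) (x : E.domain) (k : ℕ) :
    E.proj k ((diagonal T).1 x) = T k (E.proj k x) := proj_diagonalEnd T x k

theorem onBlock_diagonal (T : ∀ k, E.block k →L[ℂ] E.block k) (k : ℕ) :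
    onBlock E k (diagonal T) = T k := by
  ext x : 1
  have h := proj_apply (diagonal T) k ⟨x, E.level_le k (E.block_le_level k x.2)⟩
  rw [proj_diagonal] at h
  change T k (E.proj k (x : H)) = onBlock E k (diagonal T) (E.proj k (x : H)) at h
  rw [E.proj_coe] at h
  exact h.symm

theorem levelSeminorm_diagonal_le (T : ∀ k, E.block k →L[ℂ] E.block k) {m : ℕ} {C : ℝ}
    (hC : 0 ≤ C) (hT : ∀ k, k ≤ m → ‖T k‖ ≤ C) : levelSeminorm E m (diagonal T) ≤ C :=
  ContinuousLinearMap.opNorm_le_bound _ hC fun x =>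
    norm_diagonalEnd_le T hC hT (x := ⟨x, E.level_le m x.2⟩) x.2

theorem star_diagonal (T : ∀ k, E.block k →L[ℂ] E.block k) :
    diagonal (fun k => star (T k)) = star (diagonal T) :=
  ext_inner_cstarE E fun x y => by
    obtain ⟨m, hm⟩ := E.exists_level x
    rw [inner_star, E.inner_eq_sum hm, coe_diagonal, coe_diagonal,
      E.inner_eq_sum (diagonalEnd_mem_level T hm)]
    refine Finset.sum_congr rfl fun k _ => ?_
    rw [proj_diagonalEnd, proj_diagonalEnd, ContinuousLinearMap.star_eq_adjoint,
      ContinuousLinearMap.adjoint_inner_right]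

end Blocks

/-! ### Assembling representations from their blocks. -/

section Assembly

variable {H : Type*} [NormedAddCommGroup H] [InnerProductSpace ℂ H] [CompleteSpace H]
variable {E : QuantizedDomain H}
variable {A : Type*} [Ring A] [StarRing A] [Algebra ℂ A]

/-- The homomorphism into `C⋆_E(D)` with prescribed blocks. -/
def diagonalHom (ψ : ∀ k, A →ₗ[ℂ] (E.block k →L[ℂ] E.block k))
    (hmul : ∀ k a b, ψ k (a * b) = ψ k a * ψ k b) (hstar : ∀ k a, ψ k (star a) = star (ψ k a)) :
    A →⋆ₙₐ[ℂ] CStarE E where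
  toFun a := diagonal fun k => ψ k a
  map_smul' c a := cstarE_ext fun x k => by
    change _ = E.proj k (c • ((diagonal fun k => ψ k a).1 x : H))
    rw [proj_diagonal, map_smul, map_smul, proj_diagonal]
    rfl
  map_zero' := cstarE_ext fun x k => by
    change _ = E.proj k 0
    rw [proj_diagonal, map_zero, map_zero]
    rfl
  map_add' a b := cstarE_ext fun x k => by
    change _ = E.proj k (((diagonal fun k => ψ k a).1 x : H) + ((diagonal fun k => ψ k b).1 x : H))
    rw [proj_diagonal, map_add, map_add, proj_diagonal, proj_diagonal]
    rfl
  map_mul' a b := cstarE_ext fun x k => by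
    change _ = E.proj k ((diagonal fun k => ψ k a).1 ((diagonal fun k => ψ k b).1 x) : H)
    rw [proj_diagonal, proj_diagonal, proj_diagonal, hmul]
    rfl
  map_star' a := by
    rw [← star_diagonal]
    simp only [hstar]

theorem blockMap_diagonalHom (ψ : ∀ k, A →ₗ[ℂ] (E.block k →L[ℂ] E.block k))
    (hmul : ∀ k a b, ψ k (a * b) = ψ k a * ψ k b) (hstar : ∀ k a, ψ k (star a) = star (ψ k a))
    (k : ℕ) : blockMap (diagonalHom ψ hmul hstar) k = ψ k :=
  LinearMap.ext fun a => onBlock_diagonal (fun k => ψ k a) k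

end Assembly

end LocalCStar

end

theorem propositionP1
    {A₁ : Type*} [Ring A₁] [StarRing A₁] [Algebra ℂ A₁] [StarModule ℂ A₁] [UniformSpace A₁]
    {A₂ : Type*} [Ring A₂] [StarRing A₂] [Algebra ℂ A₂] [StarModule ℂ A₂] [UniformSpace A₂]
    (Γ₁ : ℕ → CStarSeminorm A₁) (hA₁ : IsFrechetLocallyCStarAlgebra Γ₁)
    (Γ₂ : ℕ → CStarSeminorm A₂) (hA₂ : IsFrechetLocallyCStarAlgebra Γ₂)
    (S₁ : Submodule ℂ A₁) (hS₁ : IsLocalOperatorSystem S₁) (hgen₁ : Generates S₁)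
    (S₂ : Submodule ℂ A₂) (hS₂ : IsLocalOperatorSystem S₂) (hgen₂ : Generates S₂)
    (φ : S₁ →ₗ[ℂ] S₂) (hφ_one : φ ⟨1, hS₁.one_mem⟩ = ⟨1, hS₂.one_mem⟩)
    (hφ_surj : Function.Surjective φ) (hφ : IsLocalCompletelyIsometric Γ₁ Γ₂ φ)
    {H : Type*} [NormedAddCommGroup H] [InnerProductSpace ℂ H] [CompleteSpace H]
    (E : QuantizedDomain H)
    (π₁ : A₁ →⋆ₙₐ[ℂ] CStarE E) (hπ₁ : IsGammaBoundaryRep Γ₁ S₁ π₁) :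
    ∃ π₂ : A₂ →⋆ₙₐ[ℂ] CStarE E, IsGammaBoundaryRep Γ₂ S₂ π₂ ∧
      ∀ s : S₁, π₂ (φ s) = π₁ (s : A₁) := by
  have hpair : ∀ m, IsUnitalIsometricPair (Γ₁ m) (Γ₂ m) S₁.subtype (S₂.subtype ∘ₗ φ) := fun m =>
    ⟨⟨⟨1, hS₁.one_mem⟩, rfl, congrArg Subtype.val hφ_one⟩, fun n a => hφ.isometric m n a⟩
  choose ψ hψ hext hle using fun m => (hπ₁.boundary m).exists_transfer hA₁ hA₂ hS₁ hgen₁ hS₂ hgen₂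
    hφ_surj (hpair m)
  refine ⟨diagonalHom ψ (fun m => (hψ m).irreducibleRep.map_mul)
    (fun m => (hψ m).irreducibleRep.map_star), ⟨fun m => ⟨m, fun b => ?_⟩, fun m => ?_⟩,
    fun s => cstarE_ext fun x k => ?_⟩
  -- Only the blocks `k ≤ m` act on `H_m`, and there `q_k ≤ q_m`; so `l = m` serves as the index in
  -- locality.
  · exact levelSeminorm_diagonal_le _ (apply_nonneg (Γ₂ m).toSeminorm b) fun k hk =>
      (hle k b).trans (hA₂.mono hk b)
  · rw [blockMap_diagonalHom]
    exact hψ m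
  · rw [proj_apply (π₁ s)]
    refine (proj_diagonal _ x k).trans ?_
    rw [hext]
    rfl
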